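/- All graphs are finite and simple. For a graph $G$ on $n$ vertices, let $Q(G)$ be its signless Laplacian matrix, i.e. the sum of the diagonal degree matrix and the adjacency matrix of $G$; its eigenvalues are called the signless Laplacian eigenvalues of $G$. Let $m_G[0,1)$ be the number of signless Laplacian eigenvalues of $G$, counted with multiplicity, that lie in $[0,1)$. Let $\delta(G)$ be the minimum degree of $G$ and $\nu(G)$ its matching number (the size of a maximum matching). Write $kC_5$ for the disjoint union of $k$ copies of the $5$-cycle. **Theorem.** Let $G$ be a graph with $\delta(G)\ge 2$. If $G\not\cong kC_5$ for every positive integer $k$, then $$m_G[0,1)\le \nu(G)-1.$$ The bound is sharp: for every $n\ge 4$ the complete bipartite graph $K_{2,n-2}$ satisfies the hypotheses (its minimum degree is at least $2$ and it is not isomorphic to any $kC_5$ with $k \ge 1$), and $m_{K_{2,n-2}}[0,1)=\nu(K_{2,n-2})-1$. The equality $m_{P_6}[0,1)=\nu(P_6)-1$ also holds for the path $P_6$ on six vertices. -/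

import Mathlib

namespace SimpleGraph

/-- The signless Laplacian matrix `Q(G)`: the sum of the diagonal degree matrix and the
adjacency matrix. -/
noncomputable def signlessLapMatrix {V : Type*} [Fintype V] [DecidableEq V]
    (G : SimpleGraph V) [DecidableRel G.Adj] : Matrix V V ℝ :=
  G.degMatrix ℝ + G.adjMatrix ℝ

theorem isHermitian_signlessLapMatrix {V : Type*} [Fintype V] [DecidableEq V]
    (G : SimpleGraph V) [DecidableRel G.Adj] : G.signlessLapMatrix.IsHermitian :=
  (G.isHermitian_degMatrix ℝ).add (G.isHermitian_adjMatrix ℝ)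

/-- The signless Laplacian eigenvalues of a graph on `n` vertices, listed with multiplicity in
nonincreasing order; the indices run from `0` to `n - 1`. -/
noncomputable def signlessEigenvalues {V : Type*} [Fintype V] [DecidableEq V]
    (G : SimpleGraph V) [DecidableRel G.Adj] : Fin (Fintype.card V) → ℝ :=
  G.isHermitian_signlessLapMatrix.eigenvalues₀

/-- `m_G I`: the number of signless Laplacian eigenvalues of `G` in `I`, with multiplicity. -/
noncomputable def signlessEigenvalueCount {V : Type*} [Fintype V] [DecidableEq V]
    (G : SimpleGraph V) [DecidableRel G.Adj] (I : Set ℝ) : ℕ :=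
  {i : Fin (Fintype.card V) | G.signlessEigenvalues i ∈ I}.ncard

/-- The matching number `ν(G)` of a finite graph: the largest number of edges of a matching. -/
noncomputable def matchingNumber {V : Type*} (G : SimpleGraph V) : ℕ :=
  sSup {k : ℕ | ∃ M : G.Subgraph, M.IsMatching ∧ M.edgeSet.ncard = k}

/-- The supremum in `matchingNumber` is attained by a matching when the graph is finite. -/
theorem isGreatest_matchingNumber {V : Type*} [Finite V] (G : SimpleGraph V) :
    IsGreatest {k : ℕ | ∃ M : G.Subgraph, M.IsMatching ∧ M.edgeSet.ncard = k}
      G.matchingNumber := by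
  have hb : BddAbove {k : ℕ | ∃ M : G.Subgraph, M.IsMatching ∧ M.edgeSet.ncard = k} := by
    refine ⟨G.edgeSet.ncard, ?_⟩
    rintro k ⟨M, -, rfl⟩
    exact Set.ncard_le_ncard M.edgeSet_subset (Set.toFinite _)
  refine ⟨Nat.sSup_mem ⟨0, ⊥, ?_, by simp⟩ hb, fun k hk => le_csSup hb hk⟩
  intro v hv
  simp at hv

/-- The disjoint union `kH` of `k` copies of `H`. -/
def disjointCopies {W : Type*} (k : ℕ) (H : SimpleGraph W) : SimpleGraph (Fin k × W) where
  Adj a b := a.1 = b.1 ∧ H.Adj a.2 b.2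
  symm := ⟨fun _ _ h => ⟨h.1.symm, h.2.symm⟩⟩
  loopless := ⟨fun _ h => H.loopless.irrefl _ h.2⟩

end SimpleGraph

/-! ### Counting small eigenvalues with linear forms -/

open Finset Matrix

/-! The form of `Q(G)` at `x` is the sum of `(x u + x v)²` over the edges. If `x` vanishes on a
dominating set `D`, each vertex `v` outside `D` has an edge into `D` that contributes `x v ^ 2`, so
at most `|D|` eigenvalues are below 1. Fix a maximum matching and let `A` be the set of vertices
with an unmatched neighbour. If no matching edge has both ends in `A`, then one end of each edge,
always the end in `A` if there is one, gives a dominating set of size `ν`.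

To gain one, the matching edges inside a set `R` are traded for a piece `C` on which fewer than `|R|
/ 2` linear forms suffice: a triangle (0 forms), a `K_{2,t}` (1 form), a 7-cycle (2 forms), or
nothing at all. `IsMate.signlessEigenvalueCount_lt` does this bookkeeping.

Suppose no gain is possible (`IsTight`). A triangle shows that no matching edge has both ends in
`A`; `touchesFixed_or` shows that each has at least one. If two vertices outside `A` on matching
edges are adjacent, the absence of augmenting paths closes a 5-cycle through an unmatched vertex.
That vertex has no third neighbour (`eq_or_eq_of_adj`), and switching the matching moves the
unmatched vertex all around the cycle, so the cycle is a component (`isPentagon`). A vertex outside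
all such components would yield a gain from a `K_{2,t}`. Hence the graph is `kC₅`. -/

theorem Matrix.IsHermitian.dotProduct_eigenvectorBasis {n : Type*} [Fintype n] [DecidableEq n]
    {A : Matrix n n ℝ} (hA : A.IsHermitian) (i j : n) :
    (⇑(hA.eigenvectorBasis i) : n → ℝ) ⬝ᵥ ⇑(hA.eigenvectorBasis j) = if i = j then 1 else 0 := by
  have h := orthonormal_iff_ite.1 hA.eigenvectorBasis.orthonormal j i
  rw [EuclideanSpace.inner_eq_star_dotProduct] at h
  simpa [eq_comm] using h

/-- If a quadratic form is bounded below by `t * ‖x‖²` on the common kernel of `k` linear forms,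
then at most `k` eigenvalues are smaller than `t`. -/
theorem Matrix.IsHermitian.card_eigenvalues_lt_le {n : Type*} [Fintype n] [DecidableEq n]
    {A : Matrix n n ℝ} (hA : A.IsHermitian) {k : ℕ} {t : ℝ} (L : (n → ℝ) →ₗ[ℝ] (Fin k → ℝ))
    (hL : ∀ x, L x = 0 → t * (x ⬝ᵥ x) ≤ x ⬝ᵥ (A *ᵥ x)) :
    (univ.filter fun i => hA.eigenvalues i < t).card ≤ k := by
  by_contra! hk
  set S := univ.filter fun i => hA.eigenvalues i < t with hS
  let T : (S → ℝ) →ₗ[ℝ] (n → ℝ) :=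
    Fintype.linearCombination ℝ (fun i : S => (⇑(hA.eigenvectorBasis i) : n → ℝ))
  have hdim : Module.finrank ℝ (Fin k → ℝ) < Module.finrank ℝ (S → ℝ) := by simpa using hk
  -- More than `k` eigenvectors span a space of dimension above `k`, so some nonzero combination is
  -- killed by `L`; on it the form is strictly below `t * ‖x‖²`.
  obtain ⟨c, hc, hc0⟩ := (Submodule.ne_bot_iff _).1
    (LinearMap.ker_ne_bot_of_finrank_lt (f := L ∘ₗ T) hdim)
  have hTc : T c = ∑ i : S, c i • (⇑(hA.eigenvectorBasis i) : n → ℝ) := by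
    simp [T, Fintype.linearCombination_apply]
  have h1 : T c ⬝ᵥ T c = ∑ i : S, c i ^ 2 := by
    rw [hTc]
    simp only [sum_dotProduct, dotProduct_sum, smul_dotProduct, dotProduct_smul,
      hA.dotProduct_eigenvectorBasis, Subtype.coe_inj, smul_eq_mul, mul_ite, mul_one, mul_zero]
    simp [sq]
  have h2 : T c ⬝ᵥ (A *ᵥ T c) = ∑ i : S, hA.eigenvalues i * c i ^ 2 := by
    rw [hTc]
    simp only [mulVec_sum, mulVec_smul, hA.mulVec_eigenvectorBasis, sum_dotProduct,
      dotProduct_sum, smul_dotProduct, dotProduct_smul,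
      hA.dotProduct_eigenvectorBasis, Subtype.coe_inj, smul_eq_mul, mul_ite, mul_one, mul_zero]
    exact sum_congr rfl fun i _ => by simp; ring
  have h3 := hL (T c) hc
  rw [h1, h2, mul_sum] at h3
  obtain ⟨i, hi⟩ := Function.ne_iff.1 hc0
  refine absurd h3 (not_le.2 (sum_lt_sum (fun j _ => ?_) ⟨i, mem_univ _, ?_⟩))
  · exact mul_le_mul_of_nonneg_right (mem_filter.1 j.2).2.le (sq_nonneg _)
  · exact mul_lt_mul_of_pos_right (mem_filter.1 i.2).2 (by simpa using sq_pos_of_ne_zero hi)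

namespace SimpleGraph

/-! ### The signless Laplacian form as a sum over edges -/

section Energy

variable {V : Type*} (G : SimpleGraph V) [DecidableRel G.Adj]

/-- The squared sum of the endpoint values over an ordered pair of vertices, zero if these are
not adjacent. -/
noncomputable def edgeEnergy (x : V → ℝ) (u v : V) : ℝ :=
  if G.Adj u v then (x u + x v) ^ 2 else 0

theorem edgeEnergy_nonneg (x : V → ℝ) (u v : V) : 0 ≤ G.edgeEnergy x u v := by
  unfold edgeEnergy
  split_ifs <;> positivity

theorem edgeEnergy_comm (x : V → ℝ) (u v : V) : G.edgeEnergy x u v = G.edgeEnergy x v u := by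
  unfold edgeEnergy
  simp only [G.adj_comm u v, add_comm (x u)]

variable {G} in
theorem edgeEnergy_of_adj (x : V → ℝ) {u v : V} (h : G.Adj u v) :
    G.edgeEnergy x u v = (x u + x v) ^ 2 := if_pos h

variable [Fintype V] [DecidableEq V]

/-- Ordered pairs count every edge twice, which is the source of the factor 2 in all later energy
bounds. -/
theorem two_mul_dotProduct_signlessLapMatrix (x : V → ℝ) :
    2 * (x ⬝ᵥ (G.signlessLapMatrix *ᵥ x)) = ∑ u, ∑ v, G.edgeEnergy x u v := by
  have h : x ⬝ᵥ (G.signlessLapMatrix *ᵥ x) =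
      ∑ u, ∑ v, (if G.Adj u v then x u * x u + x u * x v else 0) := by
    simp_rw [signlessLapMatrix, add_mulVec, dotProduct_add, dotProduct_mulVec_degMatrix,
      dotProduct_mulVec_adjMatrix, ← sum_add_distrib, degree_eq_sum_if_adj, sum_mul, ite_mul,
      one_mul, zero_mul, ← sum_add_distrib, ite_add_ite, add_zero]
  have h' : x ⬝ᵥ (G.signlessLapMatrix *ᵥ x) =
      ∑ u, ∑ v, (if G.Adj u v then x v * x v + x v * x u else 0) := by
    rw [h, sum_comm]
    simp_rw [G.adj_comm]
  rw [two_mul]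
  nth_rewrite 1 [h]
  rw [h', ← sum_add_distrib]
  refine sum_congr rfl fun u _ => ?_
  rw [← sum_add_distrib]
  refine sum_congr rfl fun v _ => ?_
  unfold edgeEnergy
  split_ifs <;> ring

theorem signlessEigenvalueCount_eq_card (I : Set ℝ) [DecidablePred (· ∈ I)] :
    G.signlessEigenvalueCount I =
      (univ.filter fun v => G.isHermitian_signlessLapMatrix.eigenvalues v ∈ I).card := by
  rw [signlessEigenvalueCount, ← Set.ncard_coe_finset]
  refine Set.ncard_congr
    (fun i _ => Fintype.equivOfCardEq (Fintype.card_fin _) i) ?_ ?_ ?_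
  · intro i hi
    exact mem_filter.2 ⟨mem_univ _, by
      simpa [Matrix.IsHermitian.eigenvalues, signlessEigenvalues] using hi⟩
  · intro i j _ _ h
    simpa using h
  · intro v hv
    refine ⟨(Fintype.equivOfCardEq (Fintype.card_fin _)).symm v, ?_, by simp⟩
    simpa [Matrix.IsHermitian.eigenvalues, signlessEigenvalues] using (mem_filter.1 hv).2

theorem signlessEigenvalueCount_Ico_le {k : ℕ} (L : (V → ℝ) →ₗ[ℝ] (Fin k → ℝ))
    (hL : ∀ x, L x = 0 → 2 * ∑ v, x v ^ 2 ≤ ∑ u, ∑ v, G.edgeEnergy x u v) :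
    G.signlessEigenvalueCount (Set.Ico 0 1) ≤ k := by
  classical
  rw [signlessEigenvalueCount_eq_card]
  refine (card_le_card (monotone_filter_right _ ?_)).trans
    (G.isHermitian_signlessLapMatrix.card_eigenvalues_lt_le (t := 1) L fun x hx => ?_)
  · exact fun v _ hv => hv.2
  · have := hL x hx
    rw [← two_mul_dotProduct_signlessLapMatrix] at this
    have e : x ⬝ᵥ x = ∑ v, x v ^ 2 := by simp [dotProduct, sq]
    rw [e]
    linarith

end Energy

/-! ### Dominating sets and pieces with an energy bound -/

section EnergyBound

variable {V : Type*} (G : SimpleGraph V) [DecidableRel G.Adj]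

/-- On the common kernel of some `k` linear forms, the signless Laplacian form of the subgraph
induced on `C` is at least the square norm of the restriction to `C`. -/
def HasEnergyBound (C : Finset V) (k : ℕ) : Prop :=
  ∃ L : (V → ℝ) →ₗ[ℝ] (Fin k → ℝ), ∀ x, L x = 0 →
    2 * ∑ v ∈ C, x v ^ 2 ≤ ∑ u ∈ C, ∑ v ∈ C, G.edgeEnergy x u v

theorem hasEnergyBound_empty : G.HasEnergyBound ∅ 0 := ⟨0, by simp⟩

variable {G} [DecidableEq V]

/-- The linear forms are the coordinates on `D` together with the `k` forms of `C`. The pairs inside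
`C` pay for `C`, and the pairs between `D` and the remaining vertices pay for the latter; no pair is
used twice. -/
theorem HasEnergyBound.signlessEigenvalueCount_le [Fintype V] {C D : Finset V} {k : ℕ}
    (hC : G.HasEnergyBound C k) (hCD : Disjoint C D)
    (hdom : ∀ v, v ∉ C → v ∉ D → ∃ d ∈ D, G.Adj v d) :
    G.signlessEigenvalueCount (Set.Ico 0 1) ≤ D.card + k := by
  obtain ⟨L, hL⟩ := hC
  let L' : (V → ℝ) →ₗ[ℝ] (Fin (D.card + k) → ℝ) :=
    LinearMap.pi (Fin.addCases (fun i => LinearMap.proj (D.equivFin.symm i : V))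
      (fun j => LinearMap.proj j ∘ₗ L))
  refine G.signlessEigenvalueCount_Ico_le L' fun x hx => ?_
  have hD : ∀ d ∈ D, x d = 0 := by
    intro d hd
    have := congrFun hx (Fin.castAdd k (D.equivFin ⟨d, hd⟩))
    simpa [L'] using this
  have hLx : L x = 0 := by
    funext j
    have := congrFun hx (Fin.natAdd D.card j)
    simpa [L'] using this
  set R := univ \ (C ∪ D) with hR
  have hsplit : ∀ g : V → ℝ, ∑ v, g v = ∑ v ∈ C, g v + ∑ v ∈ D, g v + ∑ v ∈ R, g v := by
    intro g
    rw [← sum_union hCD, add_comm, hR, sum_sdiff (subset_univ _)]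
  have hsub : ∀ (S : Finset V) (u : V), ∑ v ∈ S, G.edgeEnergy x u v ≤ ∑ v, G.edgeEnergy x u v :=
    fun S u => sum_le_sum_of_subset_of_nonneg (subset_univ _)
      fun v _ _ => G.edgeEnergy_nonneg x u v
  have hRD : ∑ v ∈ R, x v ^ 2 ≤ ∑ u ∈ R, ∑ v ∈ D, G.edgeEnergy x u v := by
    refine sum_le_sum fun u hu => ?_
    have hu' : u ∉ C ∧ u ∉ D := by simpa [hR] using hu
    obtain ⟨d, hd, hud⟩ := hdom u hu'.1 hu'.2
    refine le_trans (le_of_eq ?_)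
      (single_le_sum (fun v _ => G.edgeEnergy_nonneg x u v) hd)
    rw [edgeEnergy_of_adj x hud, hD d hd, add_zero]
  have hDR : ∑ u ∈ D, ∑ v ∈ R, G.edgeEnergy x u v = ∑ u ∈ R, ∑ v ∈ D, G.edgeEnergy x u v := by
    rw [sum_comm]
    simp_rw [G.edgeEnergy_comm x]
  have hD0 : ∑ v ∈ D, x v ^ 2 = 0 := sum_eq_zero fun d hd => by simp [hD d hd]
  rw [hsplit, hsplit, hD0]
  have h1 : ∑ u ∈ C, ∑ v ∈ C, G.edgeEnergy x u v ≤ ∑ u ∈ C, ∑ v, G.edgeEnergy x u v :=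
    sum_le_sum fun u _ => hsub C u
  have h2 : ∑ u ∈ D, ∑ v ∈ R, G.edgeEnergy x u v ≤ ∑ u ∈ D, ∑ v, G.edgeEnergy x u v :=
    sum_le_sum fun u _ => hsub R u
  have h3 : ∑ u ∈ R, ∑ v ∈ D, G.edgeEnergy x u v ≤ ∑ u ∈ R, ∑ v, G.edgeEnergy x u v :=
    sum_le_sum fun u _ => hsub D u
  have := hL x hLx
  linarith

/-- Chords only add nonnegative energy. The condition `2 < n` keeps the two cycle neighbours of a
vertex distinct. -/
theorem sum_image_energy_ge_of_cycle {n : ℕ} [NeZero n] (c : Fin n → V)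
    (hc : Function.Injective c) (hn : 2 < n) (hadj : ∀ i, G.Adj (c i) (c (i + 1))) (x : V → ℝ) :
    2 * ∑ i, (x (c i) + x (c (i + 1))) ^ 2 ≤
      ∑ u ∈ univ.image c, ∑ v ∈ univ.image c, G.edgeEnergy x u v := by
  rw [sum_image fun i _ j _ h => hc h]
  simp_rw [sum_image fun i _ j _ h => hc h]
  have hne : ∀ i : Fin n, i + 1 ≠ i - 1 := by
    intro i h
    have h2 : (1 : Fin n) + 1 = 0 := by
      have h' := congrArg (fun j => j - i + 1) h
      simpa [add_sub_cancel_left, sub_sub_cancel_left] using h'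
    have := congrArg Fin.val h2
    rw [Fin.val_add, Fin.val_zero, Fin.val_one', Nat.mod_eq_of_lt (by omega : 1 < n),
      Nat.mod_eq_of_lt (by omega)] at this
    omega
  have h1 : ∀ i, (x (c i) + x (c (i + 1))) ^ 2 + (x (c (i - 1)) + x (c i)) ^ 2 ≤
      ∑ j, G.edgeEnergy x (c i) (c j) := by
    intro i
    have := sum_le_sum_of_subset_of_nonneg (f := fun j => G.edgeEnergy x (c i) (c j))
      (subset_univ {i + 1, i - 1}) fun j _ _ => G.edgeEnergy_nonneg x (c i) (c j)
    rw [sum_pair (hne i), edgeEnergy_of_adj x (hadj i), edgeEnergy_comm,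
      edgeEnergy_of_adj (u := c (i - 1)) (v := c i) x (by simpa using hadj (i - 1))] at this
    exact this
  have h2 : ∑ i, (x (c (i - 1)) + x (c i)) ^ 2 = ∑ i, (x (c i) + x (c (i + 1))) ^ 2 := by
    refine Fintype.sum_equiv (Equiv.subRight 1) _ _ fun i => ?_
    simp
  have h3 := sum_le_sum fun i (_ : i ∈ univ) => h1 i
  rw [sum_add_distrib, h2] at h3
  linarith

/-- On a triangle the edge sum equals the square norm plus `(x₀ + x₁ + x₂)²`, so no linear form is
needed. -/
theorem hasEnergyBound_triangle (c : Fin 3 → V) (hc : Function.Injective c)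
    (hadj : ∀ i, G.Adj (c i) (c (i + 1))) : G.HasEnergyBound (univ.image c) 0 := by
  refine ⟨0, fun x _ => le_trans ?_ (sum_image_energy_ge_of_cycle c hc (by norm_num) hadj x)⟩
  rw [sum_image fun i _ j _ h => hc h]
  simp only [Fin.sum_univ_three, Fin.isValue, show (0 : Fin 3) + 1 = 1 from rfl,
    show (1 : Fin 3) + 1 = 2 from rfl, show (2 : Fin 3) + 1 = 0 from rfl]
  nlinarith [sq_nonneg (x (c 0) + x (c 1) + x (c 2))]

/-- The two forms fold the cycle along its axis through `c 0`. With `x₆ = -x₁` and `x₅ = x₂` the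
cross terms at `c 0` and between `c 1`, `c 2` and their mirror images cancel, and the three edges
from `c 2` to `c 5` act as a triangle on `x₂, x₃, x₄`. -/
theorem hasEnergyBound_sevenCycle (c : Fin 7 → V) (hc : Function.Injective c)
    (hadj : ∀ i, G.Adj (c i) (c (i + 1))) : G.HasEnergyBound (univ.image c) 2 := by
  let p : V → (V → ℝ) →ₗ[ℝ] ℝ := fun v => LinearMap.proj v
  refine ⟨LinearMap.pi ![p (c 1) + p (c 6), p (c 2) - p (c 5)], fun x hx => le_trans ?_
      (sum_image_energy_ge_of_cycle c hc (by norm_num) hadj x)⟩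
  have h0 : x (c 1) + x (c 6) = 0 := by simpa [p] using congrFun hx 0
  have h1 : x (c 2) - x (c 5) = 0 := by simpa [p] using congrFun hx 1
  have h6 : x (c 6) = -x (c 1) := by linarith
  have h5 : x (c 5) = x (c 2) := by linarith
  rw [sum_image fun i _ j _ h => hc h]
  simp only [Fin.sum_univ_seven, Fin.isValue, show (0 : Fin 7) + 1 = 1 from rfl,
    show (1 : Fin 7) + 1 = 2 from rfl, show (2 : Fin 7) + 1 = 3 from rfl,
    show (3 : Fin 7) + 1 = 4 from rfl, show (4 : Fin 7) + 1 = 5 from rfl,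
    show (5 : Fin 7) + 1 = 6 from rfl, show (6 : Fin 7) + 1 = 0 from rfl, h6, h5]
  nlinarith [sq_nonneg (x (c 2) + x (c 3) + x (c 4)), sq_nonneg (x (c 0)), sq_nonneg (x (c 1)),
    sq_nonneg (x (c 2))]

/-- Under `x a + x b = 0` the cross terms at each `v ∈ T` cancel and leave `2 * x v ^ 2 + 2 * x a ^
2`; a single such `v` already pays for `a` and `b`. -/
theorem hasEnergyBound_bipartite {a b : V} {T : Finset V} (hab : a ≠ b) (hT : T.Nonempty)
    (ha : ∀ v ∈ T, G.Adj v a) (hb : ∀ v ∈ T, G.Adj v b) :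
    G.HasEnergyBound ({a, b} ∪ T) 1 := by
  let p : V → (V → ℝ) →ₗ[ℝ] ℝ := fun v => LinearMap.proj v
  refine ⟨LinearMap.pi fun _ => p a + p b, fun x hx => ?_⟩
  have h0 : x a + x b = 0 := by simpa [p] using congrFun hx 0
  have hxb : x b = -x a := by linarith
  have hdisj : Disjoint ({a, b} : Finset V) T := by
    rw [Finset.disjoint_left]
    intro v hv hvT
    rcases mem_insert.1 hv with rfl | hv
    · exact (ha _ hvT).ne rfl
    · rw [mem_singleton] at hv
      subst hv
      exact (hb _ hvT).ne rfl
  have key : ∀ v ∈ T, ∑ u ∈ ({a, b} : Finset V), G.edgeEnergy x u v =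
      2 * x v ^ 2 + 2 * x a ^ 2 := by
    intro v hv
    rw [sum_pair hab, edgeEnergy_of_adj x (ha v hv).symm, edgeEnergy_of_adj x (hb v hv).symm, hxb]
    ring
  have h1 : ∑ u ∈ ({a, b} : Finset V), ∑ v ∈ T, G.edgeEnergy x u v =
      ∑ v ∈ T, (2 * x v ^ 2 + 2 * x a ^ 2) := by
    rw [sum_comm]
    exact sum_congr rfl key
  have h2 : ∑ v ∈ T, ∑ u ∈ ({a, b} : Finset V), G.edgeEnergy x v u =
      ∑ v ∈ T, (2 * x v ^ 2 + 2 * x a ^ 2) := by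
    exact sum_congr rfl fun v hv =>
      (sum_congr rfl fun u _ => G.edgeEnergy_comm x v u).trans (key v hv)
  have hsub : ∀ (S : Finset V), S ⊆ {a, b} ∪ T → ∀ u, ∑ v ∈ S, G.edgeEnergy x u v ≤
      ∑ v ∈ {a, b} ∪ T, G.edgeEnergy x u v :=
    fun S hS u => sum_le_sum_of_subset_of_nonneg hS fun v _ _ => G.edgeEnergy_nonneg x u v
  have h3 := sum_le_sum fun u (_ : u ∈ ({a, b} : Finset V)) => hsub T subset_union_right u
  have h4 := sum_le_sum fun u (_ : u ∈ T) => hsub {a, b} subset_union_left u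
  rw [sum_union hdisj, sum_union hdisj, sum_pair hab, hxb]
  have hcard : (1 : ℝ) ≤ T.card := by exact_mod_cast hT.card_pos
  have h5 : ∑ v ∈ T, (2 * x v ^ 2 + 2 * x a ^ 2) =
      2 * ∑ v ∈ T, x v ^ 2 + T.card * (2 * x a ^ 2) := by
    rw [sum_add_distrib, ← mul_sum, sum_const, nsmul_eq_mul]
  have h6 : 1 * (2 * x a ^ 2) ≤ T.card * (2 * x a ^ 2) :=
    mul_le_mul_of_nonneg_right hcard (by positivity)
  have h7 : 0 ≤ ∑ v ∈ T, x v ^ 2 := sum_nonneg fun _ _ => sq_nonneg _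
  linarith

end EnergyBound

/-! ### Matchings as involutions, and the counting lemma -/

section Mate

variable {V : Type*} (G : SimpleGraph V)

/-- An involution that sends every vertex it moves to a neighbour, which encodes a matching. -/
structure IsMate (f : V → V) : Prop where
  invol : Function.Involutive f
  adj : ∀ v, f v ≠ v → G.Adj v (f v)

theorem IsMate.card_moved_le [Fintype V] [DecidableEq V] {G : SimpleGraph V} {f : V → V}
    (hf : G.IsMate f) : (univ.filter fun v => f v ≠ v).card ≤ 2 * G.matchingNumber := by
  let M : G.Subgraph :=
    { verts := {v | f v ≠ v}
      Adj := fun u v => f u = v ∧ u ≠ v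
      adj_sub := by
        rintro u v ⟨rfl, h⟩
        exact hf.adj u h.symm
      edge_vert := by
        rintro u v ⟨rfl, h⟩
        exact h.symm
      symm := ⟨by
        rintro u v ⟨rfl, h⟩
        exact ⟨hf.invol u, h.symm⟩⟩ }
  have hM : M.IsMatching := by
    intro v hv
    exact ⟨f v, ⟨rfl, Ne.symm hv⟩, fun w hw => hw.1.symm⟩
  have hν : M.edgeSet.ncard ≤ G.matchingNumber :=
    G.isGreatest_matchingNumber.2 ⟨M, hM, rfl⟩
  have h1 := card_le_mul_card_image (f := fun v => s(v, f v))
    (univ.filter fun v => f v ≠ v) 2 ?_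
  · refine h1.trans (Nat.mul_le_mul_left 2 (le_trans ?_ hν))
    rw [← Set.ncard_coe_finset]
    refine Set.ncard_le_ncard ?_ (Set.toFinite _)
    intro e he
    obtain ⟨v, hv, rfl⟩ := mem_image.1 (mem_coe.1 he)
    exact ⟨rfl, Ne.symm (mem_filter.1 hv).2⟩
  · intro e he
    obtain ⟨v, hv, rfl⟩ := mem_image.1 he
    refine (card_le_card ?_).trans (card_le_two (a := v) (b := f v))
    intro w hw
    have := (mem_filter.1 hw).2
    rw [Sym2.eq_iff] at this
    rcases this with h | h
    · simp [h.1]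
    · simp [h.1]

/-- A set without two matched vertices extends to a set of representatives of the matching edges
outside `R`. -/
theorem exists_transversal [Fintype V] [DecidableEq V] {f : V → V}
    (hf : Function.Involutive f) (X : Set V) (R : Finset V) (hX : ∀ v ∈ X, f v ∉ X)
    (hXR : ∀ v ∈ X, v ∉ R) (hR : ∀ v ∈ R, f v ∈ R) (hR' : ∀ v ∈ R, f v ≠ v) :
    ∃ D : Finset V, (∀ v ∈ D, f v ≠ v ∧ v ∉ R) ∧ (∀ v ∈ X, f v ≠ v → v ∈ D) ∧
      (∀ v, f v ≠ v → v ∉ R → v ∉ D → f v ∈ D) ∧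
      2 * D.card + R.card ≤ (univ.filter fun v => f v ≠ v).card := by
  classical
  let r := Fintype.equivFin V
  -- An edge that meets `X` is represented by its end in `X`; any other edge by its smaller end in
  -- an arbitrary enumeration `r`.
  refine ⟨univ.filter fun v => (f v ≠ v ∧ v ∉ R) ∧ (v ∈ X ∨ (f v ∉ X ∧ r v < r (f v))),
    fun v hv => (mem_filter.1 hv).2.1, fun v hv hfv => ?_, fun v hv hvR hvD => ?_, ?_⟩
  · exact mem_filter.2 ⟨mem_univ _, ⟨hfv, hXR v hv⟩, Or.inl hv⟩
  · have hfR : f v ∉ R := fun h => hvR (by simpa [hf v] using hR _ h)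
    refine mem_filter.2 ⟨mem_univ _, ⟨by rw [hf v]; exact hv.symm, hfR⟩, ?_⟩
    rw [hf v]
    by_contra! hcon
    refine hvD (mem_filter.2 ⟨mem_univ _, ⟨hv, hvR⟩, ?_⟩)
    by_cases hvX : v ∈ X
    · exact Or.inl hvX
    · exact Or.inr ⟨hcon.1, lt_of_le_of_ne (hcon.2 hvX) fun h => hv (r.injective h).symm⟩
  · set D := univ.filter fun v => (f v ≠ v ∧ v ∉ R) ∧ (v ∈ X ∨ (f v ∉ X ∧ r v < r (f v))) with hD
    have hcard : (D.image f).card = D.card := card_image_of_injective _ hf.injective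
    have hd1 : Disjoint D (D.image f) := by
      rw [Finset.disjoint_left]
      intro v hv hv'
      obtain ⟨u, hu, rfl⟩ := mem_image.1 hv'
      have h1 := (mem_filter.1 hv).2.2
      have h2 := (mem_filter.1 hu).2.2
      rw [hf u] at h1
      rcases h1 with h1 | h1
      · rcases h2 with h2 | h2
        · exact hX u h2 h1
        · exact h2.1 h1
      · rcases h2 with h2 | h2
        · exact h1.1 h2
        · exact lt_asymm h1.2 h2.2
    have hd2 : Disjoint (D ∪ D.image f) R := by
      rw [Finset.disjoint_left]
      intro v hv hvR
      rcases mem_union.1 hv with hv | hv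
      · exact (mem_filter.1 hv).2.1.2 hvR
      · obtain ⟨u, hu, rfl⟩ := mem_image.1 hv
        exact (mem_filter.1 hu).2.1.2 (by simpa [hf u] using hR _ hvR)
    calc 2 * D.card + R.card = (D ∪ D.image f ∪ R).card := by
          rw [card_union_of_disjoint hd2, card_union_of_disjoint hd1, hcard, two_mul]
      _ ≤ _ := card_le_card fun v hv => by
          refine mem_filter.2 ⟨mem_univ _, ?_⟩
          rcases mem_union.1 hv with hv | hv
          · rcases mem_union.1 hv with hv | hv
            · exact (mem_filter.1 hv).2.1.1
            · obtain ⟨u, hu, rfl⟩ := mem_image.1 hv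
              rw [hf u]
              exact (mem_filter.1 hu).2.1.1.symm
          · exact hR' v hv

variable {G} in
-- The transversal `D` contains `X` and satisfies `2|D| + |R| ≤ 2ν`, so `2k + 2 ≤ |R|` gives `|D| +
-- k < ν`. Matched vertices outside `R` lie in `D` or are dominated by their mates, so only
-- unmatched vertices and vertices of `R` need a neighbour in `X`.
theorem IsMate.signlessEigenvalueCount_lt [Fintype V] [DecidableEq V] [DecidableRel G.Adj]
    {f : V → V} (hf : G.IsMate f) {X : Set V} {R C : Finset V} {k : ℕ}
    (hC : G.HasEnergyBound C k)
    (hR : ∀ v ∈ R, f v ∈ R) (hR' : ∀ v ∈ R, f v ≠ v)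
    (hCR : ∀ v ∈ C, v ∈ R ∨ f v = v)
    (hXR : ∀ v ∈ X, v ∉ R) (hX : ∀ v ∈ X, f v ≠ v ∧ f v ∉ X)
    (hdom : ∀ v, v ∉ C → (v ∈ R ∨ f v = v) → ∃ d ∈ X, G.Adj v d)
    (hk : 2 * k + 2 ≤ R.card) :
    G.signlessEigenvalueCount (Set.Ico 0 1) < G.matchingNumber := by
  obtain ⟨D, hD1, hD2, hD3, hD4⟩ :=
    exists_transversal hf.invol X R (fun v hv => (hX v hv).2) hXR hR hR'
  have h1 := hC.signlessEigenvalueCount_le (D := D) ?_ ?_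
  · have := hf.card_moved_le
    omega
  · rw [Finset.disjoint_left]
    intro v hv hvD
    rcases hCR v hv with h | h
    · exact (hD1 v hvD).2 h
    · exact (hD1 v hvD).1 h
  · intro v hvC hvD
    by_cases hv : v ∈ R ∨ f v = v
    · obtain ⟨d, hd, hvd⟩ := hdom v hvC hv
      exact ⟨d, hD2 d hd (hX d hd).1, hvd⟩
    · push Not at hv
      exact ⟨f v, hD3 v hv.2 hv.1 hvD, hf.adj v hv.2⟩

end Mate

/-! ### Maximum matchings, switching and augmenting paths -/

section MaxMate

variable {V : Type*} (G : SimpleGraph V)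

/-- A mate function of a maximum matching. -/
structure IsMaxMate (f : V → V) : Prop extends G.IsMate f where
  ncard_le : ∀ g, G.IsMate g → {v | f v = v}.ncard ≤ {v | g v = v}.ncard

theorem exists_isMaxMate : ∃ f, G.IsMaxMate f := by
  have hid : G.IsMate id := ⟨fun _ => rfl, fun _ h => absurd rfl h⟩
  have hne : {k | ∃ f, G.IsMate f ∧ {v | f v = v}.ncard = k}.Nonempty := ⟨_, id, hid, rfl⟩
  obtain ⟨f, hf, hk⟩ := Nat.sInf_mem hne
  exact ⟨f, hf, fun g hg => hk ▸ Nat.sInf_le ⟨g, hg, rfl⟩⟩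

/-- The mate function that matches `w` to `a` instead of matching `a` to `f a`. -/
def switchMate [DecidableEq V] (f : V → V) (w a : V) : V → V :=
  fun v => Equiv.swap w (f a) (f (Equiv.swap w (f a) v))

variable {G} {f : V → V}

theorem IsMate.ne_of_adj_fixed (hf : G.IsMate f) {w a : V} (hw : f w = w) (hwa : G.Adj w a) :
    f a ≠ w := fun h => hwa.ne (by rw [← hf.invol a, h, hw])

theorem IsMaxMate.not_adj [Finite V] (hf : G.IsMaxMate f) {u v : V} (hu : f u = u)
    (hv : f v = v) : ¬ G.Adj u v := by
  classical
  intro h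
  have hne := h.ne
  let g : V → V := fun x => if x = u then v else if x = v then u else f x
  have hfu : ∀ x, x ≠ u → f x ≠ u := fun x hx hxu => hx (by rw [← hf.invol x, hxu, hu])
  have hfv : ∀ x, x ≠ v → f x ≠ v := fun x hx hxv => hx (by rw [← hf.invol x, hxv, hv])
  have hgu : g u = v := if_pos rfl
  have hgv : g v = u := by simp [g, hne.symm]
  have hgx : ∀ x, x ≠ u → x ≠ v → g x = f x := fun x h1 h2 => by simp [g, h1, h2]
  have hg : G.IsMate g := by
    constructor
    · intro x
      by_cases h1 : x = u
      · rw [h1, hgu, hgv]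
      by_cases h2 : x = v
      · rw [h2, hgv, hgu]
      rw [hgx x h1 h2, hgx _ (hfu x h1) (hfv x h2), hf.invol x]
    · intro x hx
      by_cases h1 : x = u
      · rw [h1, hgu]
        exact h
      by_cases h2 : x = v
      · rw [h2, hgv]
        exact h.symm
      rw [hgx x h1 h2] at hx ⊢
      exact hf.adj x hx
  refine absurd (hf.ncard_le g hg) (not_le.2 (Set.ncard_lt_ncard ?_ (Set.toFinite _)))
  refine ⟨fun x hx => ?_, fun hsub => ?_⟩
  · by_cases h1 : x = u
    · exact h1 ▸ hu
    by_cases h2 : x = v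
    · exact h2 ▸ hv
    exact (hgx x h1 h2).symm.trans hx
  · exact hne (hgu.symm.trans (hsub hu)).symm

theorem IsMaxMate.ne_of_adj [Finite V] (hf : G.IsMaxMate f) {w a : V} (hw : f w = w)
    (hwa : G.Adj w a) : f a ≠ a := fun ha => hf.not_adj hw ha hwa

section Switch

variable [DecidableEq V] {w a : V}

theorem switchMate_apply_mate (hw : f w = w) : switchMate f w a (f a) = f a := by
  simp [switchMate, hw]

theorem IsMate.switchMate_apply_left (hf : G.IsMate f) (hwa : G.Adj w a) (ha : f a ≠ a) :
    switchMate f w a w = a := by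
  simp [switchMate, hf.invol a, Equiv.swap_apply_of_ne_of_ne hwa.ne.symm ha.symm]

theorem switchMate_apply_right (hwa : G.Adj w a) (ha : f a ≠ a) :
    switchMate f w a a = w := by
  simp [switchMate, Equiv.swap_apply_of_ne_of_ne hwa.ne.symm ha.symm]

theorem IsMate.switchMate_apply_of_ne (hf : G.IsMate f) (hw : f w = w) {v : V} (h1 : v ≠ w)
    (h2 : v ≠ a) (h3 : v ≠ f a) : switchMate f w a v = f v := by
  rw [switchMate, Equiv.swap_apply_of_ne_of_ne h1 h3, Equiv.swap_apply_of_ne_of_ne]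
  · exact fun h => h1 (by rw [← hf.invol v, h, hw])
  · exact fun h => h2 (hf.invol.injective h)

/-- The new map is the conjugate of `f` by the transposition of `w` and `f a`, so it is again an
involution with equally many fixed vertices. -/
theorem IsMaxMate.switchMate [Finite V] (hf : G.IsMaxMate f) (hw : f w = w) (hwa : G.Adj w a) :
    G.IsMaxMate (switchMate f w a) := by
  have ha := hf.ne_of_adj hw hwa
  refine ⟨⟨fun v => ?_, fun v hv => ?_⟩, fun g hg => ?_⟩
  · simp [SimpleGraph.switchMate, hf.invol _]
  · by_cases h1 : v = w
    · rw [h1, hf.switchMate_apply_left hwa ha]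
      exact hwa
    by_cases h2 : v = a
    · rw [h2, switchMate_apply_right hwa ha]
      exact hwa.symm
    by_cases h3 : v = f a
    · exact absurd (by rw [h3]; exact switchMate_apply_mate hw) hv
    rw [hf.switchMate_apply_of_ne hw h1 h2 h3] at hv ⊢
    exact hf.adj v hv
  · refine le_trans (le_of_eq ?_) (hf.ncard_le g hg)
    have : {v | SimpleGraph.switchMate f w a v = v} = Equiv.swap w (f a) '' {v | f v = v} := by
      ext v
      simp only [Set.mem_ofPred_eq, Set.mem_image_equiv, Equiv.symm_swap,
        SimpleGraph.switchMate]
      rw [Equiv.swap_apply_eq_iff]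
    rw [this, Set.ncard_image_of_injective _ (Equiv.injective _)]

end Switch

/-- Otherwise `w₁, a, f a, w₂` is an augmenting path: switching `w₁` to `a` leaves the adjacent
vertices `f a` and `w₂` both unmatched. -/
theorem IsMaxMate.eq_of_adj_adj [Finite V] (hf : G.IsMaxMate f) {a w₁ w₂ : V} (h₁ : f w₁ = w₁)
    (h₂ : f w₂ = w₂) (ha₁ : G.Adj a w₁) (ha₂ : G.Adj (f a) w₂) : w₁ = w₂ := by
  classical
  by_contra hne
  have h3 : w₂ ≠ a := fun h => by
    subst h
    exact hf.not_adj h₂ h₁ ha₁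
  refine (hf.switchMate h₁ ha₁.symm).not_adj (switchMate_apply_mate h₁) ?_ ha₂
  rw [hf.switchMate_apply_of_ne h₁ (Ne.symm hne) h3 ha₂.ne.symm, h₂]

/-- Two matched edges with an edge between them are not part of an augmenting path. -/
theorem IsMaxMate.eq_of_adj_of_adj_mate [Finite V] (hf : G.IsMaxMate f) {a₁ a₂ w₁ w₂ : V}
    (h₁ : f w₁ = w₁) (h₂ : f w₂ = w₂) (ha₁ : G.Adj a₁ w₁) (ha₂ : G.Adj a₂ w₂)
    (hb : G.Adj (f a₁) (f a₂)) : w₁ = w₂ := by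
  classical
  by_contra hne
  have hn₁ := hf.ne_of_adj h₁ ha₁.symm
  have hn₂ := hf.ne_of_adj h₂ ha₂.symm
  by_cases hcase : f a₂ = a₁
  · refine hne (hf.eq_of_adj_adj h₁ h₂ ha₁ ?_)
    rwa [← hcase, hf.invol]
  have h3 : f a₂ ≠ w₁ := fun h => hn₂ (by
    rw [← h, hf.invol] at h₁
    exact h₁.symm)
  have hw₂ : SimpleGraph.switchMate f w₁ a₁ w₂ = w₂ := by
    rw [hf.switchMate_apply_of_ne h₁ (Ne.symm hne), h₂]
    · rintro rfl
      exact hn₁ h₂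
    · rintro rfl
      rw [hf.invol] at h₂
      exact hn₁ h₂.symm
  have hmate : SimpleGraph.switchMate f w₁ a₁ (f a₂) = a₂ := by
    rw [hf.switchMate_apply_of_ne h₁ h3 hcase hb.ne.symm, hf.invol]
  -- After the switch `f a₁` is unmatched, and the augmenting path has lost one matched edge.
  have := (hf.switchMate h₁ ha₁.symm).eq_of_adj_adj (a := f a₂) (switchMate_apply_mate h₁) hw₂
    hb.symm (by rw [hmate]; exact ha₂)
  rw [← this, hf.invol] at h₂
  exact hn₁ h₂.symm

/-- Three matched edges joined to a path are not part of an augmenting path. -/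
theorem IsMaxMate.eq_of_adj_of_adj_of_adj [Finite V] (hf : G.IsMaxMate f) {a₁ a₂ w₁ w₂ p : V}
    (h₁ : f w₁ = w₁) (h₂ : f w₂ = w₂) (ha₁ : G.Adj a₁ w₁) (ha₂ : G.Adj a₂ w₂)
    (hp : f p ≠ p) (hpa₁ : p ≠ a₁) (ha : a₂ ≠ a₁) (hb : a₂ ≠ f a₁)
    (hb₁ : G.Adj (f a₁) p) (hb₂ : G.Adj (f p) (f a₂)) : w₁ = w₂ := by
  classical
  by_contra hne
  have hn₁ := hf.ne_of_adj h₁ ha₁.symm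
  have hn₂ := hf.ne_of_adj h₂ ha₂.symm
  have hw₂ : SimpleGraph.switchMate f w₁ a₁ w₂ = w₂ := by
    rw [hf.switchMate_apply_of_ne h₁ (Ne.symm hne), h₂]
    · rintro rfl
      exact hn₁ h₂
    · rintro rfl
      rw [hf.invol] at h₂
      exact hn₁ h₂.symm
  have hp' : SimpleGraph.switchMate f w₁ a₁ p = f p := by
    refine hf.switchMate_apply_of_ne h₁ ?_ hpa₁ hb₁.ne.symm
    rintro rfl
    exact hp h₁
  have ha₂' : SimpleGraph.switchMate f w₁ a₁ a₂ = f a₂ := by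
    refine hf.switchMate_apply_of_ne h₁ ?_ ha hb
    rintro rfl
    exact hn₂ h₁
  have := (hf.switchMate h₁ ha₁.symm).eq_of_adj_of_adj_mate (a₁ := p) (a₂ := a₂)
    (switchMate_apply_mate h₁) hw₂ hb₁.symm ha₂ (by rw [hp', ha₂']; exact hb₂)
  rw [← this, hf.invol] at h₂
  exact hn₁ h₂.symm

end MaxMate

/-! ### Local structure of a tight graph -/

section Tight

variable {V : Type*} (G : SimpleGraph V)

/-- The vertex `a` has a neighbour fixed by `f`. -/
def TouchesFixed (f : V → V) (a : V) : Prop := ∃ w, f w = w ∧ G.Adj w a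

variable {G} in
theorem IsMaxMate.ne_of_touchesFixed [Finite V] {f : V → V} (hf : G.IsMaxMate f)
    {a : V} (ha : G.TouchesFixed f a) :
    f a ≠ a := by
  obtain ⟨w, hw, ha⟩ := ha
  exact hf.ne_of_adj hw ha

variable [Fintype V] [DecidableEq V] [DecidableRel G.Adj]

/-- Every vertex has two neighbours, but the number of eigenvalues in `[0, 1)` is not smaller than
the matching number. -/
structure IsTight : Prop where
  exists_adj : ∀ v u, ∃ u', u' ≠ u ∧ G.Adj v u'
  not_lt : ¬ G.signlessEigenvalueCount (Set.Ico 0 1) < G.matchingNumber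

variable {G} {f : V → V}

/-- The edge from `a` to `f a` is traded for the triangle on `w, a, f a`, which costs no form. -/
theorem IsTight.not_adj_mate (hG : G.IsTight) (hf : G.IsMaxMate f) {w a : V} (hw : f w = w)
    (hwa : G.Adj w a) : ¬ G.Adj w (f a) := by
  intro hwb
  have hn := hf.ne_of_adj hw hwa
  have hχ : ∀ v, ∃ u, G.Adj v u := fun v => (hG.exists_adj v v).imp fun _ h => h.2
  choose χ hχ using hχ
  have hinj : Function.Injective ![a, f a, w] := by
    intro i j
    fin_cases i <;> fin_cases j <;>
      simp [hn, hn.symm, hwa.ne, hwb.ne, hwa.ne.symm, hwb.ne.symm]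
  have hC : G.HasEnergyBound (univ.image ![a, f a, w]) 0 := by
    refine hasEnergyBound_triangle _ hinj fun i => ?_
    fin_cases i
    · exact hf.adj a hn
    · exact hwb.symm
    · exact hwa
  -- Other matching edges might still have both ends next to unmatched vertices, so `X` takes only
  -- one chosen neighbour `χ w'` of each unmatched `w' ≠ w`.
  refine hG.not_lt (hf.toIsMate.signlessEigenvalueCount_lt (R := {a, f a})
    (X := {x | ∃ w', f w' = w' ∧ w' ≠ w ∧ χ w' = x}) hC ?_ ?_ ?_ ?_ ?_ ?_ ?_)
  · simp [hf.invol a]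
  · simp [hf.invol a, hn, hn.symm]
  · simp only [mem_image, mem_univ, true_and, Fin.exists_fin_succ, mem_insert, mem_singleton]
    simp only [Matrix.cons_val_zero, Matrix.cons_val_succ, IsEmpty.exists_iff, or_false]
    rintro v (rfl | rfl | rfl)
    · exact Or.inl (Or.inl rfl)
    · exact Or.inl (Or.inr rfl)
    · exact Or.inr hw
  · rintro _ ⟨w', hw', hne, rfl⟩ hmem
    rcases mem_insert.1 hmem with h | h
    · exact hne (hf.eq_of_adj_adj hw' hw (h ▸ (hχ w').symm) hwb.symm)
    · rw [mem_singleton] at h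
      exact hne (hf.eq_of_adj_adj (a := f a) hw' hw (h ▸ (hχ w').symm)
        (by rw [hf.invol]; exact hwa.symm))
  · rintro _ ⟨w', hw', hne, rfl⟩
    refine ⟨hf.ne_of_adj hw' (hχ w'), ?_⟩
    rintro ⟨w'', hw'', -, h⟩
    have := hf.eq_of_adj_adj hw' hw'' (hχ w').symm (h ▸ (hχ w'').symm)
    subst this
    exact hf.ne_of_adj hw' (hχ w') h.symm
  · intro v hvC hv
    refine ⟨χ v, ⟨v, ?_, ?_, rfl⟩, hχ v⟩
    · refine hv.resolve_left fun h => hvC ?_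
      rcases mem_insert.1 h with h | h
      · exact mem_image.2 ⟨0, mem_univ _, h.symm⟩
      · exact mem_image.2 ⟨1, mem_univ _, (mem_singleton.1 h).symm⟩
    · rintro rfl
      exact hvC (mem_image.2 ⟨2, mem_univ _, rfl⟩)
  · rw [card_pair hn.symm]

theorem IsTight.not_touchesFixed_mate (hG : G.IsTight) (hf : G.IsMaxMate f) {a : V}
    (ha : G.TouchesFixed f a) : ¬ G.TouchesFixed f (f a) := by
  rintro ⟨w₂, h₂, hb⟩
  obtain ⟨w₁, h₁, ha⟩ := ha
  obtain rfl := hf.eq_of_adj_adj h₁ h₂ ha.symm hb.symm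
  exact hG.not_adj_mate hf h₁ ha hb

theorem IsTight.false_of_touchesFixed (hG : G.IsTight) (hf : G.IsMaxMate f)
    {C R : Finset V} {k : ℕ} (hC : G.HasEnergyBound C k)
    (hR : ∀ v ∈ R, f v ∈ R) (hR' : ∀ v ∈ R, f v ≠ v) (hCR : ∀ v ∈ C, v ∈ R ∨ f v = v)
    (hdom : ∀ v, v ∉ C → (v ∈ R ∨ f v = v) → ∃ d, G.TouchesFixed f d ∧ d ∉ R ∧ G.Adj v d)
    (hk : 2 * k + 2 ≤ R.card) : False := by
  refine hG.not_lt (hf.toIsMate.signlessEigenvalueCount_lt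
    (X := {x | G.TouchesFixed f x ∧ x ∉ R}) hC hR hR' hCR ?_ ?_ ?_ hk)
  · exact fun v hv => hv.2
  · exact fun v hv => ⟨hf.ne_of_touchesFixed hv.1, fun h => hG.not_touchesFixed_mate hf hv.1 h.1⟩
  · intro v h1 h2
    obtain ⟨d, hd, hdR, hvd⟩ := hdom v h1 h2
    exact ⟨d, ⟨hd, hdR⟩, hvd⟩

/-- A 7-cycle through three matched edges and one fixed vertex is impossible if all other fixed
vertices have a neighbour elsewhere. -/
theorem IsTight.false_of_sevenCycle (hG : G.IsTight) (hf : G.IsMaxMate f) (c : Fin 7 → V)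
    {w : V} {R : Finset V} (hadj : ∀ i, G.Adj (c i) (c (i + 1)))
    (hw : f w = w) (hR : ∀ v ∈ R, f v ∈ R) (hR' : ∀ v ∈ R, f v ≠ v) (hcard : R.card = 6)
    (hRc : insert w R ⊆ univ.image c)
    (hdom : ∀ v, f v = v → v ≠ w → ∃ d, d ∉ R ∧ G.Adj v d) : False := by
  have hwR : w ∉ R := fun h => hR' w h hw
  have himg : univ.image c = insert w R := by
    refine (eq_of_subset_of_card_le hRc ?_).symm
    rw [card_insert_of_notMem hwR, hcard]
    exact card_image_le.trans (by simp)
  have hinj : Function.Injective c := by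
    rw [← Set.injOn_univ, ← coe_univ, ← card_image_iff, himg, card_insert_of_notMem hwR, hcard]
    rfl
  refine hG.false_of_touchesFixed hf (hasEnergyBound_sevenCycle c hinj hadj) hR hR' ?_ ?_
    hcard.ge
  · intro v hv
    rw [himg] at hv
    rcases mem_insert.1 hv with rfl | hv
    · exact Or.inr hw
    · exact Or.inl hv
  · intro v hv hv'
    rw [himg, mem_insert, not_or] at hv
    have hfv := hv'.resolve_left hv.2
    obtain ⟨d, hd, hvd⟩ := hdom v hfv hv.1
    exact ⟨d, ⟨v, hfv, hvd⟩, hd, hvd⟩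

/-- If neither end of the edge `p, q` has an unmatched neighbour, the edge is dropped and `p, q` are
dominated by other neighbours `x, y`. This fails only if `x, y` are mates, which gives a 4-cycle, or
if some unmatched `w` has no neighbours besides `f x` and `f y`, which gives a 7-cycle. -/
theorem IsTight.touchesFixed_or (hG : G.IsTight) (hf : G.IsMaxMate f) {p : V} (hp : f p ≠ p) :
    G.TouchesFixed f p ∨ G.TouchesFixed f (f p) := by
  by_contra! hcon
  obtain ⟨hp1, hq1⟩ := hcon
  obtain ⟨q, hq⟩ : ∃ q, q = f p := ⟨_, rfl⟩
  rw [← hq] at hp hq1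
  have hfq : f q = p := by rw [hq, hf.invol]
  obtain ⟨x, hxq, hpx⟩ := hG.exists_adj p q
  obtain ⟨y, hyp, hqy⟩ := hG.exists_adj q p
  have hpq : G.Adj p q := by rw [hq]; exact hf.adj p (hq ▸ hp)
  have hx : f x ≠ x := fun h => hp1 ⟨x, h, hpx.symm⟩
  have hy : f y ≠ y := fun h => hq1 ⟨y, h, hqy.symm⟩
  have hxp : x ≠ p := hpx.ne.symm
  have hyq : y ≠ q := hqy.ne.symm
  have hfxp : f x ≠ p := fun h => hxq (by rw [hq, ← h, hf.invol])
  have hfxq : f x ≠ q := fun h => hxp (by rw [← hfq, ← h, hf.invol])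
  have hfyp : f y ≠ p := fun h => hyq (by rw [hq, ← h, hf.invol])
  have hfyq : f y ≠ q := fun h => hyp (by rw [← hfq, ← h, hf.invol])
  by_cases hyx : y = f x
  · subst hyx
    refine hG.false_of_touchesFixed hf (C := {x, q} ∪ {p, f x}) (R := {p, q, x, f x}) (k := 1)
      (hasEnergyBound_bipartite hxq ⟨p, by simp⟩ ?_ ?_) ?_ ?_ ?_ ?_ ?_
    · simpa using ⟨hpx, (hf.adj x hx).symm⟩
    · simpa using ⟨hpq, hqy.symm⟩
    · simp [← hq, hfq, hf.invol x]
    · simp [← hq, hfq, hf.invol x, hp, hp.symm, hx, hx.symm]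
    · intro v hv
      left
      simp only [mem_union, mem_insert, mem_singleton] at hv ⊢
      tauto
    · intro v hvC hv
      have hvfix : f v = v := by
        refine hv.resolve_left fun h => hvC ?_
        simp only [mem_union, mem_insert, mem_singleton] at h ⊢
        tauto
      obtain ⟨u, -, hu⟩ := hG.exists_adj v v
      obtain ⟨u', huu', hu'⟩ := hG.exists_adj v u
      have key : ∀ z, G.Adj v z → z ∈ ({p, q, x, f x} : Finset V) → z = x ∨ z = f x := by
        intro z hz hzR
        simp only [mem_insert, mem_singleton] at hzR
        rcases hzR with rfl | rfl | h
        · exact absurd ⟨v, hvfix, hz⟩ hp1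
        · exact absurd ⟨v, hvfix, hz⟩ hq1
        · exact h
      by_contra! hno
      have h1 := key u hu (by by_contra h; exact hno u ⟨v, hvfix, hu⟩ h hu)
      have h2 := key u' hu' (by by_contra h; exact hno u' ⟨v, hvfix, hu'⟩ h hu')
      have h3 : G.Adj v x ∧ G.Adj v (f x) := by
        rcases h1 with rfl | rfl <;> rcases h2 with rfl | rfl
        · exact absurd rfl huu'
        · exact ⟨hu, hu'⟩
        · exact ⟨hu', hu⟩
        · exact absurd rfl huu'
      exact hG.not_adj_mate hf hvfix h3.1 h3.2
    · rw [card_insert_of_notMem, card_insert_of_notMem, card_pair hx.symm]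
      · simp [hxq.symm, hyq.symm]
      · simp [hp.symm, hxp.symm, hyp.symm]
  have hxfy : x ≠ f y := fun h => hyx (by rw [h, hf.invol])
  by_cases hw : ∃ w, f w = w ∧ ∀ u, G.Adj w u → u = f x ∨ u = f y
  · obtain ⟨w, hw, hwN⟩ := hw
    have h3 : G.Adj w (f x) ∧ G.Adj w (f y) := by
      obtain ⟨u, -, hu⟩ := hG.exists_adj w w
      obtain ⟨u', huu', hu'⟩ := hG.exists_adj w u
      rcases hwN u hu with rfl | rfl <;> rcases hwN u' hu' with rfl | rfl
      · exact absurd rfl huu'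
      · exact ⟨hu, hu'⟩
      · exact ⟨hu', hu⟩
      · exact absurd rfl huu'
    have hxy : x ≠ y := by
      rintro rfl
      obtain ⟨u', huu', hu'⟩ := hG.exists_adj w (f x)
      rcases hwN u' hu' with h | h <;> exact huu' h
    have hfxy : f x ≠ f y := fun h => hxy (hf.invol.injective h)
    have hx1 : ¬ G.TouchesFixed f x := by
      simpa [hf.invol x] using hG.not_touchesFixed_mate hf (a := f x) ⟨w, hw, h3.1⟩
    have hy1 : ¬ G.TouchesFixed f y := by
      simpa [hf.invol y] using hG.not_touchesFixed_mate hf (a := f y) ⟨w, hw, h3.2⟩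
    refine hG.false_of_sevenCycle hf ![w, f x, x, p, q, y, f y] (w := w)
      (R := {f x, x, p, q, y, f y}) ?_ hw ?_ ?_ ?_ ?_ ?_
    · intro i
      fin_cases i
      · exact h3.1
      · exact (hf.adj x hx).symm
      · exact hpx.symm
      · exact hpq
      · exact hqy
      · exact hf.adj y hy
      · exact h3.2.symm
    · simp [← hq, hfq, hf.invol x, hf.invol y]
    · simp [← hq, hfq, hf.invol x, hf.invol y, hp, hp.symm, hx, hx.symm, hy, hy.symm]
    · rw [card_insert_of_notMem, card_insert_of_notMem, card_insert_of_notMem,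
        card_insert_of_notMem, card_pair hy.symm]
      · simp [hyq.symm, hfyq.symm]
      · simp [hp.symm, hyp.symm, hfyp.symm]
      · simp [hxp, hxq, hxy, hxfy]
      · simp [hx, hfxp, hfxq, hfxy, Ne.symm hyx]
    · intro v hv
      simp only [mem_insert, mem_singleton] at hv
      rcases hv with h | h | h | h | h | h | h
      exacts [mem_image.2 ⟨0, mem_univ _, h.symm⟩, mem_image.2 ⟨1, mem_univ _, h.symm⟩,
        mem_image.2 ⟨2, mem_univ _, h.symm⟩, mem_image.2 ⟨3, mem_univ _, h.symm⟩,
        mem_image.2 ⟨4, mem_univ _, h.symm⟩, mem_image.2 ⟨5, mem_univ _, h.symm⟩,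
        mem_image.2 ⟨6, mem_univ _, h.symm⟩]
    · intro v hv hvw
      have hv1 : ¬ G.Adj v (f x) := by
        intro h
        refine hvw (hf.eq_of_adj_of_adj_of_adj (a₁ := f x) (a₂ := f y) (p := p) hv hw h.symm
          h3.2.symm (hq ▸ hp) hfxp.symm hfxy.symm ?_ ?_ ?_)
        · rw [hf.invol]; exact hxfy.symm
        · rw [hf.invol]; exact hpx.symm
        · rw [hf.invol, ← hq]; exact hqy
      have hv2 : ¬ G.Adj v (f y) := by
        intro h
        refine hvw (hf.eq_of_adj_of_adj_of_adj (a₁ := f x) (a₂ := f y) (p := p) hw hv h3.1.symm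
          h.symm (hq ▸ hp) hfxp.symm hfxy.symm ?_ ?_ ?_).symm
        · rw [hf.invol]; exact hxfy.symm
        · rw [hf.invol]; exact hpx.symm
        · rw [hf.invol, ← hq]; exact hqy
      obtain ⟨u, -, hu⟩ := hG.exists_adj v v
      refine ⟨u, ?_, hu⟩
      simp only [mem_insert, mem_singleton]
      rintro (rfl | rfl | rfl | rfl | rfl | rfl)
      · exact hv1 hu
      · exact hx1 ⟨v, hv, hu⟩
      · exact hp1 ⟨v, hv, hu⟩
      · exact hq1 ⟨v, hv, hu⟩
      · exact hy1 ⟨v, hv, hu⟩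
      · exact hv2 hu
  -- The generic case: `x` and `y` are forced into `D`, which excludes `f x` and `f y`; each
  -- unmatched vertex has another neighbour.
  · push Not at hw
    refine hG.not_lt (hf.toIsMate.signlessEigenvalueCount_lt (R := {p, q})
      (X := {v | v = x ∨ v = y ∨ (G.TouchesFixed f v ∧ v ≠ f x ∧ v ≠ f y)})
      G.hasEnergyBound_empty ?_ ?_ ?_ ?_ ?_ ?_ ?_)
    · simp [← hq, hfq]
    · simp [← hq, hfq, hp, hp.symm]
    · simp
    · rintro v hv hvR
      rw [mem_insert, mem_singleton] at hvR
      rcases hvR with rfl | rfl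
      · rcases hv with h | h | h
        · exact hxp h.symm
        · exact hyp h.symm
        · exact hp1 h.1
      · rcases hv with h | h | h
        · exact hxq h.symm
        · exact hyq h.symm
        · exact hq1 h.1
    · rintro v (rfl | rfl | ⟨h1, h2, h3⟩)
      · refine ⟨hx, ?_⟩
        rintro (h | h | h)
        · exact hx h
        · exact hyx h.symm
        · exact h.2.1 rfl
      · refine ⟨hy, ?_⟩
        rintro (h | h | h)
        · exact hxfy h.symm
        · exact hy h
        · exact h.2.2 rfl
      · refine ⟨hf.ne_of_touchesFixed h1, ?_⟩
        rintro (h | h | h)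
        · exact h2 (by rw [← h, hf.invol])
        · exact h3 (by rw [← h, hf.invol])
        · exact hG.not_touchesFixed_mate hf h1 h.1
    · rintro v - (hv | hv)
      · rw [mem_insert, mem_singleton] at hv
        rcases hv with rfl | rfl
        · exact ⟨x, Or.inl rfl, hpx⟩
        · exact ⟨y, Or.inr (Or.inl rfl), hqy⟩
      · obtain ⟨u, hu, h1, h2⟩ := hw v hv
        exact ⟨u, Or.inr (Or.inr ⟨⟨v, hv, hu⟩, h1, h2⟩), hu⟩
    · rw [card_pair hp.symm]

end Tight

/-! ### Pentagons are components and cover a tight graph -/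

section Pentagon

variable {V : Type*} {G : SimpleGraph V} {f : V → V}

section Tight

variable [Fintype V] [DecidableEq V] [DecidableRel G.Adj]

/-- Given a third neighbour `u` of `w`, switching `w` to `u` makes `f u` unmatched.
`touchesFixed_or` for the new matching then ties `f u` to both edges of the 5-cycle, and each way of
doing so gives a gain. -/
theorem IsTight.eq_or_eq_of_adj (hG : G.IsTight) (hf : G.IsMaxMate f) {w a₁ a₂ u : V}
    (hw : f w = w) (h₁ : G.Adj w a₁) (h₂ : G.Adj w a₂) (ha : a₁ ≠ a₂)
    (hb : G.Adj (f a₁) (f a₂)) (hu : G.Adj w u) : u = a₁ ∨ u = a₂ := by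
  by_contra! hcon
  obtain ⟨hu₁, hu₂⟩ := hcon
  have key : ∀ {a}, G.Adj w a → ¬ G.TouchesFixed f (f a) := fun h =>
    hG.not_touchesFixed_mate hf ⟨w, hw, h⟩
  have hne : ∀ {a}, G.Adj w a → f a ≠ a := fun h => hf.ne_of_adj hw h
  have hne' : ∀ {a c}, G.Adj w a → G.Adj w c → f a ≠ c := by
    rintro a _ h h' rfl
    exact key h ⟨w, hw, h'⟩
  have hnew : ∀ {a}, G.Adj w a → f a ≠ w := fun h => hf.toIsMate.ne_of_adj_fixed hw h
  have hfne : ∀ {a c}, a ≠ c → f a ≠ f c := fun h h' => h (hf.invol.injective h')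
  have hN₁ : ∀ v, f v = v → G.Adj v a₁ → v = w := fun v hv h =>
    hf.eq_of_adj_of_adj_mate hv hw h.symm h₂.symm hb
  have hN₂ : ∀ v, f v = v → G.Adj v a₂ → v = w := fun v hv h =>
    (hf.eq_of_adj_of_adj_mate hw hv h₁.symm h.symm hb).symm
  have hout : ∀ v, f v = v → v ≠ w → ∃ d, d ∉ ({a₁, f a₁, a₂, f a₂, u, f u} : Finset V) ∧
      G.Adj v d := by
    intro v hv hvw
    obtain ⟨d, hd, hvd⟩ := hG.exists_adj v u
    refine ⟨d, ?_, hvd⟩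
    simp only [mem_insert, mem_singleton]
    rintro (rfl | rfl | rfl | rfl | rfl | rfl)
    · exact hvw (hN₁ v hv hvd)
    · exact key h₁ ⟨v, hv, hvd⟩
    · exact hvw (hN₂ v hv hvd)
    · exact key h₂ ⟨v, hv, hvd⟩
    · exact hd rfl
    · exact key hu ⟨v, hv, hvd⟩
  have hRf : ∀ v ∈ ({a₁, f a₁, a₂, f a₂, u, f u} : Finset V),
      f v ∈ ({a₁, f a₁, a₂, f a₂, u, f u} : Finset V) := by
    simp [hf.invol _]
  have hRn : ∀ v ∈ ({a₁, f a₁, a₂, f a₂, u, f u} : Finset V), f v ≠ v := by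
    simp [hf.invol _, hne h₁, hne h₂, hne hu, (hne h₁).symm, (hne h₂).symm, (hne hu).symm]
  have hcard : ({a₁, f a₁, a₂, f a₂, u, f u} : Finset V).card = 6 := by
    rw [card_insert_of_notMem, card_insert_of_notMem, card_insert_of_notMem,
      card_insert_of_notMem, card_pair (hne hu).symm]
    · simp [hne' h₂ hu, hfne hu₂.symm]
    · simp [(hne h₂).symm, hu₂.symm, (hne' hu h₂).symm]
    · simp [hne' h₁ h₂, hne' h₁ hu, hfne ha, hfne hu₁.symm]
    · simp [(hne h₁).symm, ha, hu₁.symm, (hne' hu h₁).symm, (hne' h₂ h₁).symm]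
  set f' := switchMate f w u with hf'def
  have hf' : G.IsMaxMate f' := hf.switchMate hw hu
  have hf'w : f' w = u := hf.switchMate_apply_left hu (hne hu)
  have hf'u : f' u = w := switchMate_apply_right hu (hne hu)
  have hf'b : f' (f u) = f u := switchMate_apply_mate hw
  have hf'v : ∀ v, v ≠ w → v ≠ u → v ≠ f u → f' v = f v := fun v =>
    hf.switchMate_apply_of_ne hw
  have hfix : ∀ v, f' v = v → v = f u ∨ (f v = v ∧ v ≠ w) := by
    intro v hv
    by_cases h1 : v = w
    · subst h1
      exact absurd (hv.symm.trans hf'w) hu.ne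
    by_cases h2 : v = u
    · subst h2
      exact absurd (hf'u.symm.trans hv) hu.ne
    by_cases h3 : v = f u
    · exact Or.inl h3
    · exact Or.inr ⟨(hf'v v h1 h2 h3).symm.trans hv, h1⟩
  have hf'₁ : f' a₁ = f a₁ := hf'v _ h₁.ne.symm hu₁.symm (hne' hu h₁).symm
  have hf'₂ : f' a₂ = f a₂ := hf'v _ h₂.ne.symm hu₂.symm (hne' hu h₂).symm
  -- Among the vertices unmatched under `f'`, only `f u` can be adjacent to an end of this edge: the
  -- old ones are excluded by `hN₁` and `key`.
  have ht₁ : G.Adj (f u) a₁ ∨ G.Adj (f u) (f a₁) := by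
    rcases hG.touchesFixed_or hf' (p := a₁) (by rw [hf'₁]; exact hne h₁) with
      ⟨v, hv, hva⟩ | ⟨v, hv, hva⟩
    · rcases hfix v hv with rfl | ⟨h, h'⟩
      · exact Or.inl hva
      · exact absurd (hN₁ v h hva) h'
    · rw [hf'₁] at hva
      rcases hfix v hv with rfl | ⟨h, h'⟩
      · exact Or.inr hva
      · exact absurd ⟨v, h, hva⟩ (key h₁)
  have ht₂ : G.Adj (f u) a₂ ∨ G.Adj (f u) (f a₂) := by
    rcases hG.touchesFixed_or hf' (p := a₂) (by rw [hf'₂]; exact hne h₂) with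
      ⟨v, hv, hva⟩ | ⟨v, hv, hva⟩
    · rcases hfix v hv with rfl | ⟨h, h'⟩
      · exact Or.inl hva
      · exact absurd (hN₂ v h hva) h'
    · rw [hf'₂] at hva
      rcases hfix v hv with rfl | ⟨h, h'⟩
      · exact Or.inr hva
      · exact absurd ⟨v, h, hva⟩ (key h₂)
  rcases ht₂ with ht₂ | ht₂
  · refine hG.false_of_sevenCycle hf ![w, a₁, f a₁, f a₂, a₂, f u, u] ?_ hw hRf hRn hcard ?_ hout
    · intro i
      fin_cases i
      · exact h₁
      · exact hf.adj a₁ (hne h₁)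
      · exact hb
      · exact (hf.adj a₂ (hne h₂)).symm
      · exact ht₂.symm
      · exact (hf.adj u (hne hu)).symm
      · exact hu.symm
    · intro v hv
      simp only [mem_insert, mem_singleton] at hv
      rcases hv with h | h | h | h | h | h | h
      exacts [mem_image.2 ⟨0, mem_univ _, h.symm⟩, mem_image.2 ⟨1, mem_univ _, h.symm⟩,
        mem_image.2 ⟨2, mem_univ _, h.symm⟩, mem_image.2 ⟨4, mem_univ _, h.symm⟩,
        mem_image.2 ⟨3, mem_univ _, h.symm⟩, mem_image.2 ⟨6, mem_univ _, h.symm⟩,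
        mem_image.2 ⟨5, mem_univ _, h.symm⟩]
  rcases ht₁ with ht₁ | ht₁
  · refine hG.false_of_sevenCycle hf ![w, a₂, f a₂, f a₁, a₁, f u, u] ?_ hw hRf hRn hcard ?_ hout
    · intro i
      fin_cases i
      · exact h₂
      · exact hf.adj a₂ (hne h₂)
      · exact hb.symm
      · exact (hf.adj a₁ (hne h₁)).symm
      · exact ht₁.symm
      · exact (hf.adj u (hne hu)).symm
      · exact hu.symm
    · intro v hv
      simp only [mem_insert, mem_singleton] at hv
      rcases hv with h | h | h | h | h | h | h
      exacts [mem_image.2 ⟨0, mem_univ _, h.symm⟩, mem_image.2 ⟨4, mem_univ _, h.symm⟩,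
        mem_image.2 ⟨3, mem_univ _, h.symm⟩, mem_image.2 ⟨1, mem_univ _, h.symm⟩,
        mem_image.2 ⟨2, mem_univ _, h.symm⟩, mem_image.2 ⟨6, mem_univ _, h.symm⟩,
        mem_image.2 ⟨5, mem_univ _, h.symm⟩]
  have hb₁ : f' (f a₁) = a₁ := by rw [← hf'₁, hf'.invol]
  -- Now `f u` is adjacent to `f a₁`, and the edge `a₂, f a₂` is dropped: `w` dominates `a₂`, while
  -- `f a₁` dominates both `f a₂` and `f u`. The mates `u` and `a₁` of `w` and `f a₁` under `f'`
  -- must stay out of `X`.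
  refine hG.not_lt (hf'.toIsMate.signlessEigenvalueCount_lt (R := {a₂, f a₂})
    (X := {v | v = w ∨ v = f a₁ ∨
      (G.TouchesFixed f v ∧ v ≠ u ∧ v ≠ a₁ ∧ v ≠ a₂)}) G.hasEnergyBound_empty ?_ ?_ ?_ ?_ ?_ ?_ ?_)
  · simp only [mem_insert, mem_singleton]
    rintro v (rfl | rfl)
    · exact Or.inr hf'₂
    · exact Or.inl (by rw [← hf'₂, hf'.invol])
  · simp only [mem_insert, mem_singleton]
    rintro v (rfl | rfl)
    · rw [hf'₂]
      exact hne h₂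
    · rw [← hf'₂, hf'.invol, hf'₂]
      exact (hne h₂).symm
  · simp
  · intro v hv hvR
    rw [mem_insert, mem_singleton] at hvR
    rcases hvR with rfl | rfl
    · rcases hv with h | h | h
      · exact h₂.ne h.symm
      · exact hne' h₁ h₂ h.symm
      · exact h.2.2.2 rfl
    · rcases hv with h | h | h
      · exact hnew h₂ h
      · exact hfne ha h.symm
      · exact key h₂ h.1
  · rintro v (rfl | rfl | ⟨h, hvu, hv₁, hv₂⟩)
    · rw [hf'w]
      refine ⟨hu.ne.symm, ?_⟩
      rintro (h | h | h)
      · exact hu.ne h.symm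
      · exact hne' h₁ hu h.symm
      · exact h.2.1 rfl
    · rw [hb₁]
      refine ⟨(hne h₁).symm, ?_⟩
      rintro (h | h | h)
      · exact h₁.ne h.symm
      · exact hne h₁ h.symm
      · exact h.2.2.1 rfl
    · have hvw : v ≠ w := by
        rintro rfl
        exact hf.ne_of_touchesFixed h hw
      have hvb : v ≠ f u := by
        rintro rfl
        exact key hu h
      rw [hf'v v hvw hvu hvb]
      refine ⟨hf.ne_of_touchesFixed h, ?_⟩
      rintro (h' | h' | h')
      · rw [← hf.invol v, h', hw] at hvw
        exact hvw rfl
      · exact hv₁ (hf.invol.injective h')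
      · exact hG.not_touchesFixed_mate hf h h'.1
  · rintro v - (hv | hv)
    · rw [mem_insert, mem_singleton] at hv
      rcases hv with rfl | rfl
      · exact ⟨w, Or.inl rfl, h₂.symm⟩
      · exact ⟨f a₁, Or.inr (Or.inl rfl), hb.symm⟩
    · rcases hfix v hv with rfl | ⟨h, h'⟩
      · exact ⟨f a₁, Or.inr (Or.inl rfl), ht₁⟩
      · obtain ⟨d, hd, hvd⟩ := hout v h h'
        simp only [mem_insert, mem_singleton, not_or] at hd
        exact ⟨d, Or.inr (Or.inr ⟨⟨v, h, hvd⟩, hd.2.2.2.2.1, hd.1, hd.2.2.1⟩), hvd⟩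
  · rw [card_pair (hne h₂).symm]

end Tight

variable (G) in
/-- The cycle `c` is a connected component of `G`. -/
structure IsPentagon (c : Fin 5 → V) : Prop where
  injective : Function.Injective c
  adj_iff : ∀ i u, G.Adj (c i) u ↔ u = c (i + 1) ∨ u = c (i - 1)

variable (G) in
/-- The cycle `c` contains the fixed vertex `c 0` and two matched edges. -/
structure IsMatePentagon (f : V → V) (c : Fin 5 → V) : Prop where
  fixed : f (c 0) = c 0
  mate₁ : f (c 1) = c 2
  mate₃ : f (c 3) = c 4
  adj₀ : G.Adj (c 0) (c 1)
  adj₂ : G.Adj (c 2) (c 3)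
  adj₄ : G.Adj (c 0) (c 4)
  ne : c 1 ≠ c 4

variable [Fintype V] [DecidableEq V] [DecidableRel G.Adj]

/-- Matching `c 0` to `c 1` leaves `c 2` unmatched, so the same 5-cycle read from `c 2` has the
required form. -/
theorem IsTight.exists_isMatePentagon (hG : G.IsTight) (hf : G.IsMaxMate f) {c : Fin 5 → V}
    (hc : G.IsMatePentagon f c) :
    ∃ f', G.IsMaxMate f' ∧ G.IsMatePentagon f' (fun i => c (i + 2)) := by
  have h1 := hf.ne_of_adj hc.fixed hc.adj₀
  have h4 := hf.ne_of_adj hc.fixed hc.adj₄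
  have h43 : f (c 4) = c 3 := by rw [← hc.mate₃, hf.invol]
  have ht3 : ¬ G.TouchesFixed f (c 3) := by
    rw [← h43]
    exact hG.not_touchesFixed_mate hf ⟨_, hc.fixed, hc.adj₄⟩
  have h31 : c 3 ≠ c 1 := fun h => ht3 (h ▸ ⟨_, hc.fixed, hc.adj₀⟩)
  have h30 : c 3 ≠ c 0 := fun h => by
    rw [← h43] at h
    exact hf.toIsMate.ne_of_adj_fixed hc.fixed hc.adj₄ h
  refine ⟨switchMate f (c 0) (c 1), hf.switchMate hc.fixed hc.adj₀, ?_, ?_, ?_, hc.adj₂, ?_, ?_,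
    h31⟩
  · change switchMate f (c 0) (c 1) (c 2) = c 2
    rw [← hc.mate₁]
    exact switchMate_apply_mate hc.fixed
  · change switchMate f (c 0) (c 1) (c 3) = c 4
    rw [hf.switchMate_apply_of_ne hc.fixed h30 h31 (by rw [hc.mate₁]; exact hc.adj₂.ne.symm),
      hc.mate₃]
  · exact hf.switchMate_apply_left hc.adj₀ h1
  · exact hc.adj₄.symm
  · change G.Adj (c 2) (c 1)
    rw [← hc.mate₁]
    exact (hf.adj _ h1).symm

theorem IsTight.isPentagon (hG : G.IsTight) (hf : G.IsMaxMate f) {c : Fin 5 → V}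
    (hc : G.IsMatePentagon f c) : G.IsPentagon c := by
  have hrot : ∀ k : ℕ, ∃ f', G.IsMaxMate f' ∧
      G.IsMatePentagon f' (fun i => c ((fun j => j + 2)^[k] i)) := by
    intro k
    induction k with
    | zero => exact ⟨f, hf, hc⟩
    | succ k ih =>
      obtain ⟨f', hf', hc'⟩ := ih
      exact hG.exists_isMatePentagon hf' hc'
  have hrot' : ∀ i : Fin 5, ∃ f', G.IsMaxMate f' ∧ G.IsMatePentagon f' (fun j => c (j + i)) := by
    intro i
    -- Since `3 * 2 = 1` modulo 5, `3 * i` rotations by 2 amount to a shift by `i`; every vertex of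
    -- the cycle can thus play the unmatched one.
    have h := hrot (3 * i.val)
    have e : ∀ i : Fin 5, (fun j => j + 2)^[3 * i.val] = fun j => j + i := by decide
    rwa [e] at h
  constructor
  · have h1 : ∀ i, c (i + 1) ≠ c i := fun i h => by
      obtain ⟨f', -, hc'⟩ := hrot' i
      have := hc'.adj₀.ne
      rw [zero_add, add_comm, h] at this
      exact this rfl
    have h2 : ∀ i, c (i + 3) ≠ c i := fun i h => by
      obtain ⟨f', -, hc'⟩ := hrot' (i - 1)
      refine hc'.ne ?_
      have e1 : ∀ i : Fin 5, 1 + (i - 1) = i := by decide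
      have e4 : ∀ i : Fin 5, 4 + (i - 1) = i + 3 := by decide
      rw [e1, e4, h]
    intro i j hij
    have hcases : ∀ i j : Fin 5, i = j ∨ i = j + 1 ∨ j = i + 1 ∨ i = j + 3 ∨ j = i + 3 := by
      decide
    rcases hcases i j with h | rfl | rfl | rfl | rfl
    · exact h
    · exact absurd hij (h1 _)
    · exact absurd hij.symm (h1 _)
    · exact absurd hij (h2 _)
    · exact absurd hij.symm (h2 _)
  · intro i u
    obtain ⟨f', hf', hc'⟩ := hrot' i
    have e0 : c (0 + i) = c i := by rw [zero_add]
    have e1 : c (1 + i) = c (i + 1) := by rw [add_comm]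
    have e4 : c (4 + i) = c (i - 1) := by rw [add_comm, sub_eq_add_neg]; rfl
    have h0 := hc'.fixed
    have ha1 := hc'.adj₀
    have ha4 := hc'.adj₄
    have hne := hc'.ne
    have h43 : f' (c (4 + i)) = c (3 + i) := by rw [← hc'.mate₃, hf'.invol]
    have hb : G.Adj (f' (c (1 + i))) (f' (c (4 + i))) := by
      rw [h43, hc'.mate₁]
      exact hc'.adj₂
    rw [← e0, ← e1, ← e4]
    constructor
    · exact hG.eq_or_eq_of_adj hf' h0 ha1 ha4 hne hb
    · rintro (rfl | rfl)
      · exact ha1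
      · exact ha4

theorem IsTight.forall_exists_isPentagon (hG : G.IsTight) (v : V) :
    ∃ c, G.IsPentagon c ∧ v ∈ Set.range c := by
  classical
  obtain ⟨f, hf⟩ := G.exists_isMaxMate
  let P : V → Prop := fun v => ∃ c, G.IsPentagon c ∧ v ∈ Set.range c
  have hP : ∀ {u v}, G.Adj u v → P u → P v := by
    rintro _ v h ⟨c, hc, i, rfl⟩
    rcases (hc.adj_iff i v).1 h with rfl | rfl
    · exact ⟨c, hc, _, rfl⟩
    · exact ⟨c, hc, _, rfl⟩
  by_contra hv
  -- For adjacent `u, z` both without unmatched neighbours, `f u` and `f z` have one, and it is the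
  -- same `w` as there is no augmenting path; then `w, f u, u, z, f z` is a pentagon.
  have hNA : ∀ u, ¬ P u → ¬ G.TouchesFixed f u → ∀ z, G.Adj u z → G.TouchesFixed f z := by
    intro u hu huA z huz
    by_contra hzA
    have hun : f u ≠ u := fun h => hzA ⟨u, h, huz⟩
    have hzn : f z ≠ z := fun h => huA ⟨z, h, huz.symm⟩
    obtain ⟨w, hw, hwu⟩ := (hG.touchesFixed_or hf hun).resolve_left huA
    obtain ⟨w', hw', hwz⟩ := (hG.touchesFixed_or hf hzn).resolve_left hzA
    have := hf.eq_of_adj_of_adj_mate hw hw' hwu.symm hwz.symm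
      (by rw [hf.invol, hf.invol]; exact huz)
    subst this
    refine hu ⟨![w, f u, u, z, f z], hG.isPentagon hf ⟨hw, hf.invol u, rfl, hwu, huz, hwz, ?_⟩,
      2, rfl⟩
    exact fun h => huz.ne (hf.invol.injective h)
  obtain ⟨z, hzP, hzA⟩ : ∃ z, ¬ P z ∧ ¬ G.TouchesFixed f z := by
    by_cases hvA : G.TouchesFixed f v
    · refine ⟨f v, fun h => hv (hP (hf.adj v (hf.ne_of_touchesFixed hvA)).symm h),
        hG.not_touchesFixed_mate hf hvA⟩
    · exact ⟨v, hv, hvA⟩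
  -- For matched `z` the choice `a = f z` puts `z` into `R`, so that `z` always qualifies for the
  -- `K_{2,t}` on `a, b`.
  obtain ⟨a, hza, hzf⟩ : ∃ a, G.Adj z a ∧ (f z = z ∨ f z = a) := by
    by_cases hz : f z = z
    · obtain ⟨a, -, ha⟩ := hG.exists_adj z z
      exact ⟨a, ha, Or.inl hz⟩
    · exact ⟨f z, hf.adj z hz, Or.inr rfl⟩
  obtain ⟨b, hba, hzb⟩ := hG.exists_adj z a
  have haA := hNA z hzP hzA a hza
  have hbA := hNA z hzP hzA b hzb
  have haP : ¬ P a := fun h => hzP (hP hza.symm h)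
  have hbP : ¬ P b := fun h => hzP (hP hzb.symm h)
  have han := hf.ne_of_touchesFixed haA
  have hbn := hf.ne_of_touchesFixed hbA
  have hfaA := hG.not_touchesFixed_mate hf haA
  have hfbA := hG.not_touchesFixed_mate hf hbA
  set R : Finset V := {a, f a, b, f b} with hR
  have hRA : ∀ d, d ∈ R → G.TouchesFixed f d → d = a ∨ d = b := by
    intro d hd hdA
    simp only [hR, mem_insert, mem_singleton] at hd
    rcases hd with rfl | rfl | rfl | rfl
    · exact Or.inl rfl
    · exact absurd hdA hfaA
    · exact Or.inr rfl
    · exact absurd hdA hfbA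
  -- All common neighbours of `a` and `b` that are unmatched or in `R` enter the piece. Any other
  -- such vertex has a neighbour in `A` outside `R`, because `A` meets `R` only in `a` and `b`.
  refine hG.false_of_touchesFixed hf (R := R) (C := {a, b} ∪
    univ.filter fun v => (v ∈ R ∨ f v = v) ∧ G.Adj v a ∧ G.Adj v b)
    (hasEnergyBound_bipartite hba.symm ⟨z, ?_⟩ ?_ ?_) ?_ ?_ ?_ ?_ ?_
  · refine mem_filter.2 ⟨mem_univ _, ?_, hza, hzb⟩
    rcases hzf with h | h
    · exact Or.inr h
    · left
      rw [← hf.invol z, h]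
      simp [hR]
  · exact fun v hv => (mem_filter.1 hv).2.2.1
  · exact fun v hv => (mem_filter.1 hv).2.2.2
  · simp [hR, hf.invol _]
  · simp [hR, hf.invol _, han, han.symm, hbn, hbn.symm]
  · intro v hv
    rcases mem_union.1 hv with hv | hv
    · left
      simp only [hR, mem_insert, mem_singleton] at hv ⊢
      tauto
    · exact (mem_filter.1 hv).2.1
  · intro v hvC hv
    rw [mem_union, not_or, mem_filter] at hvC
    have hvab : v ≠ a ∧ v ≠ b := by simpa [not_or] using hvC.1
    have hnot : ¬ (G.Adj v a ∧ G.Adj v b) := fun h => hvC.2 ⟨mem_univ _, hv, h⟩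
    by_cases hvP : P v
    · have hvf : f v = v := by
        refine hv.resolve_left fun h => ?_
        simp only [hR, mem_insert, mem_singleton] at h
        rcases h with rfl | rfl | rfl | rfl
        · exact haP hvP
        · exact haP (hP (hf.adj a han).symm hvP)
        · exact hbP hvP
        · exact hbP (hP (hf.adj b hbn).symm hvP)
      obtain ⟨d, -, hd⟩ := hG.exists_adj v v
      have hdA : G.TouchesFixed f d := ⟨v, hvf, hd⟩
      refine ⟨d, hdA, fun hdR => ?_, hd⟩
      rcases hRA d hdR hdA with rfl | rfl
      · exact haP (hP hd hvP)
      · exact hbP (hP hd hvP)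
    · have hvA : ¬ G.TouchesFixed f v := by
        intro h
        rcases hv with hv | hv
        · rcases hRA v hv h with h | h
          · exact hvab.1 h
          · exact hvab.2 h
        · exact hf.ne_of_touchesFixed h hv
      obtain ⟨d, -, hd⟩ := hG.exists_adj v v
      obtain ⟨d', hdd', hd'⟩ := hG.exists_adj v d
      have hdA := hNA v hvP hvA d hd
      have hdA' := hNA v hvP hvA d' hd'
      by_contra! hno
      have h1 := hRA d (by by_contra h; exact hno d hdA h hd) hdA
      have h2 := hRA d' (by by_contra h; exact hno d' hdA' h hd') hdA'
      rcases h1 with rfl | rfl <;> rcases h2 with rfl | rfl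
      · exact hdd' rfl
      · exact hnot ⟨hd, hd'⟩
      · exact hnot ⟨hd', hd⟩
      · exact hdd' rfl
  · have hab : f a ≠ b := fun h => hfaA (h ▸ hbA)
    have hba' : a ≠ f b := fun h => hfbA (h ▸ haA)
    have hff : f a ≠ f b := fun h => hba (hf.invol.injective h).symm
    rw [hR, card_insert_of_notMem, card_insert_of_notMem, card_pair hbn.symm]
    · simp [hab, hff]
    · simp [han.symm, hba.symm, hba']

end Pentagon

/-! ### From pentagon components to `kC₅` -/

section Iso

variable {V : Type*} [Fintype V] {G : SimpleGraph V}

theorem exists_iso_disjointCopies_cycleGraph [Nonempty V]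
    (h : ∀ v, ∃ c, G.IsPentagon c ∧ v ∈ Set.range c) :
    ∃ k, 0 < k ∧ Nonempty (G ≃g disjointCopies k (cycleGraph 5)) := by
  classical
  have hK : ∀ K : G.ConnectedComponent, ∃ c, G.IsPentagon c ∧
      ∀ v, v ∈ Set.range c ↔ G.connectedComponentMk v = K := by
    intro K
    obtain ⟨v, rfl⟩ := K.exists_rep
    obtain ⟨c, hc, i, rfl⟩ := h v
    refine ⟨c, hc, fun u => ?_⟩
    change _ ↔ G.connectedComponentMk u = G.connectedComponentMk (c i)
    rw [ConnectedComponent.eq]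
    constructor
    · rintro ⟨j, rfl⟩
      have hreach : ∀ k : ℕ, G.Reachable (c ((fun j => j + 1)^[k] i)) (c i) := by
        intro k
        induction k with
        | zero => exact Reachable.refl _
        | succ k ih =>
          rw [Function.iterate_succ_apply']
          exact Reachable.trans (Adj.reachable ((hc.adj_iff _ _).2 (Or.inl rfl)).symm) ih
      have e : ∀ i j : Fin 5, (fun j => j + 1)^[(j - i).val] i = j := by decide
      have hj := hreach (j - i).val
      rwa [e] at hj
    · rintro ⟨p⟩
      have : ∀ {x y : V}, G.Walk x y → y ∈ Set.range c → x ∈ Set.range c := by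
        intro x y p
        induction p with
        | nil => exact id
        | cons hadj _ ih =>
          intro hy
          obtain ⟨j, rfl⟩ := ih hy
          rcases (hc.adj_iff j _).1 hadj.symm with rfl | rfl <;> exact ⟨_, rfl⟩
      exact this p ⟨i, rfl⟩
  choose c hc hcK using hK
  have hmk : ∀ K i, G.connectedComponentMk (c K i) = K := fun K i => (hcK K _).1 ⟨i, rfl⟩
  let e := Fintype.equivFin G.ConnectedComponent
  let F : Fin (Fintype.card G.ConnectedComponent) × Fin 5 → V := fun x => c (e.symm x.1) x.2
  have hF : Function.Bijective F := by
    constructor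
    · rintro ⟨k, i⟩ ⟨l, j⟩ hij
      have hkl : k = l := by
        have := congrArg G.connectedComponentMk hij
        simpa [F, hmk] using this
      subst hkl
      have := (hc _).injective hij
      simp only at this
      rw [this]
    · intro v
      obtain ⟨i, hi⟩ := (hcK _ v).2 rfl
      exact ⟨(e (G.connectedComponentMk v), i), by simpa [F] using hi⟩
  refine ⟨Fintype.card G.ConnectedComponent, Fintype.card_pos, ⟨RelIso.symm
    { toEquiv := Equiv.ofBijective F hF, map_rel_iff' := ?_ }⟩⟩
  rintro ⟨k, i⟩ ⟨l, j⟩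
  change G.Adj (c (e.symm k) i) (c (e.symm l) j) ↔ k = l ∧ (cycleGraph 5).Adj i j
  have hcyc : ∀ i j : Fin 5, (cycleGraph 5).Adj i j ↔ j = i + 1 ∨ j = i - 1 := by decide
  constructor
  · intro hadj
    have hkl : k = l := by
      have := ConnectedComponent.sound hadj.reachable
      simpa [hmk] using this
    subst hkl
    refine ⟨rfl, (hcyc i j).2 ?_⟩
    rcases ((hc _).adj_iff i _).1 hadj with h | h
    · exact Or.inl ((hc _).injective h)
    · exact Or.inr ((hc _).injective h)
  · rintro ⟨rfl, hij⟩
    rw [(hc _).adj_iff]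
    rcases (hcyc i j).1 hij with rfl | rfl
    · exact Or.inl rfl
    · exact Or.inr rfl

end Iso

theorem signlessEigenvalueCount_lt_matchingNumber {V : Type*} [Fintype V] [DecidableEq V]
    (G : SimpleGraph V) [DecidableRel G.Adj] (hδ : 2 ≤ G.minDegree)
    (hC : ∀ k : ℕ, 0 < k → ¬ Nonempty (G ≃g disjointCopies k (cycleGraph 5))) :
    G.signlessEigenvalueCount (Set.Ico 0 1) < G.matchingNumber := by
  by_contra hlt
  have hne : Nonempty V := by
    by_contra hV
    rw [not_nonempty_iff] at hV
    -- The empty graph has minimum degree 0 by convention, so it is excluded and the number of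
    -- copies is positive.
    rw [minDegree_of_subsingleton] at hδ
    omega
  have hG : G.IsTight := by
    refine ⟨fun v u => ?_, hlt⟩
    have hdeg : 1 < (G.neighborFinset v).card := by
      rw [card_neighborFinset_eq_degree]
      exact hδ.trans (G.minDegree_le_degree v)
    obtain ⟨u', hu', hne⟩ := exists_mem_ne hdeg u
    exact ⟨u', hne, (G.mem_neighborFinset v u').1 hu'⟩
  obtain ⟨k, hk, hiso⟩ := exists_iso_disjointCopies_cycleGraph hG.forall_exists_isPentagon
  exact hC k hk hiso

/-! ### Sharpness: `K_{2,n-2}` and `P₆` -/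

section Examples

variable {V : Type*} [Fintype V] {G : SimpleGraph V}

/-- A vertex cover `S` meets every matching edge, and each vertex of `S` lies on at most one of
them. -/
theorem matchingNumber_le_card {S : Finset V} (hS : ∀ u v, G.Adj u v → u ∈ S ∨ v ∈ S) :
    G.matchingNumber ≤ S.card := by
  classical
  obtain ⟨M, hM, hcard⟩ := G.isGreatest_matchingNumber.1
  rw [← hcard, ← Set.ncard_coe_finset]
  let g : V → Sym2 V := fun v => if h : ∃ w, M.Adj v w then s(v, h.choose) else s(v, v)
  have hg : ∀ {v w}, M.Adj v w → g v = s(v, w) := by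
    intro v w h
    have h' : ∃ w, M.Adj v w := ⟨w, h⟩
    simp only [g, dif_pos h']
    rw [hM.eq_of_adj_left h'.choose_spec h]
  have hsub : M.edgeSet ⊆ g '' S := by
    intro e
    induction e using Sym2.ind with
    | _ u v =>
      intro he
      rw [Subgraph.mem_edgeSet] at he
      rcases hS u v he.adj_sub with h | h
      · exact ⟨u, h, hg he⟩
      · exact ⟨v, h, by rw [hg he.symm, Sym2.eq_swap]⟩
  exact (Set.ncard_le_ncard hsub (Set.toFinite _)).trans (Set.ncard_image_le (Set.toFinite _))

variable [DecidableEq V] [DecidableRel G.Adj]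

theorem signlessLapMatrix_mulVec_apply (x : V → ℝ) (v : V) :
    (G.signlessLapMatrix *ᵥ x) v = ∑ u, if G.Adj v u then x v + x u else 0 := by
  rw [signlessLapMatrix, add_mulVec, Pi.add_apply, degMatrix_mulVec_apply,
    degree_eq_sum_if_adj, sum_mul, adjMatrix_mulVec_apply, neighborFinset_eq_filter, sum_filter,
    ← sum_add_distrib]
  refine sum_congr rfl fun u _ => ?_
  split_ifs <;> simp

theorem exists_eigenvalues_eq {x : V → ℝ} (hx : x ≠ 0) {t : ℝ}
    (h : G.signlessLapMatrix *ᵥ x = t • x) :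
    ∃ i, G.isHermitian_signlessLapMatrix.eigenvalues i = t := by
  have h1 : t ∈ spectrum ℝ G.signlessLapMatrix := by
    rw [← Matrix.spectrum_toLin']
    refine (Module.End.hasEigenvalue_of_hasEigenvector (x := x) ⟨?_, hx⟩).mem_spectrum
    rw [Module.End.mem_eigenspace_iff, Matrix.toLin'_apply, h]
  rwa [G.isHermitian_signlessLapMatrix.spectrum_real_eq_range_eigenvalues] at h1

theorem two_le_degree_of_adj {v a b : V} (hab : a ≠ b) (ha : G.Adj v a) (hb : G.Adj v b) :
    2 ≤ G.degree v := by
  rw [← card_pair hab, ← card_neighborFinset_eq_degree]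
  refine card_le_card fun u hu => ?_
  rw [mem_insert, mem_singleton] at hu
  rcases hu with rfl | rfl <;> simpa

theorem two_le_minDegree_completeBipartiteGraph {m : ℕ} (hm : 2 ≤ m)
    [DecidableRel (completeBipartiteGraph (Fin 2) (Fin m)).Adj] :
    2 ≤ (completeBipartiteGraph (Fin 2) (Fin m)).minDegree := by
  refine le_minDegree_of_forall_le_degree _ _ fun v => ?_
  rcases v with v | v
  · exact two_le_degree_of_adj (a := Sum.inr ⟨0, by omega⟩) (b := Sum.inr ⟨1, by omega⟩)
      (by simp) (by simp) (by simp)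
  · exact two_le_degree_of_adj (a := Sum.inl 0) (b := Sum.inl 1) (by simp) (by simp) (by simp)

/-- The two sides would properly 2-colour an odd cycle. -/
theorem not_nonempty_completeBipartiteGraph_iso {A B : Type*} {k : ℕ} (hk : 0 < k) :
    ¬ Nonempty (completeBipartiteGraph A B ≃g disjointCopies k (cycleGraph 5)) := by
  rintro ⟨φ⟩
  have hcol : ∀ c : Fin 5 → Bool, ¬ ∀ i, c i ≠ c (i + 1) := by decide
  refine hcol (fun i => (φ.symm (⟨0, hk⟩, i)).isLeft) fun i => ?_
  have hcyc : ∀ i : Fin 5, (cycleGraph 5).Adj i (i + 1) := by decide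
  have hadj : (disjointCopies k (cycleGraph 5)).Adj (⟨0, hk⟩, i) (⟨0, hk⟩, i + 1) :=
    ⟨rfl, hcyc i⟩
  have h := φ.symm.map_rel_iff.2 hadj
  rw [completeBipartiteGraph_adj] at h
  rcases h with h | h
  · simp only [ne_eq]
    cases h1 : φ.symm (⟨0, hk⟩, i) <;> cases h2 : φ.symm (⟨0, hk⟩, i + 1) <;> simp_all
  · simp only [ne_eq]
    cases h1 : φ.symm (⟨0, hk⟩, i) <;> cases h2 : φ.symm (⟨0, hk⟩, i + 1) <;> simp_all

/-- The inequality and `ν ≤ 2` leave at most one eigenvalue in `[0, 1)`; the vector that is 1 on one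
side and -1 on the other gives the eigenvalue 0. -/
theorem signlessEigenvalueCount_completeBipartiteGraph_two {m : ℕ} (hm : 2 ≤ m)
    [DecidableRel (completeBipartiteGraph (Fin 2) (Fin m)).Adj] :
    (completeBipartiteGraph (Fin 2) (Fin m)).signlessEigenvalueCount (Set.Ico 0 1) + 1 =
      (completeBipartiteGraph (Fin 2) (Fin m)).matchingNumber := by
  classical
  have h1 := signlessEigenvalueCount_lt_matchingNumber
    (completeBipartiteGraph (Fin 2) (Fin m)) (two_le_minDegree_completeBipartiteGraph hm)
    fun _ hk => not_nonempty_completeBipartiteGraph_iso hk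
  have h2 : (completeBipartiteGraph (Fin 2) (Fin m)).matchingNumber ≤ 2 := by
    refine (matchingNumber_le_card (S := univ.image Sum.inl) fun u v h => ?_).trans
      (card_image_le.trans (by simp))
    rcases h with h | h
    · obtain ⟨a, rfl⟩ := Sum.isLeft_iff.1 h.1
      simp
    · obtain ⟨a, rfl⟩ := Sum.isLeft_iff.1 h.2
      simp
  have h3 : 0 <
      (completeBipartiteGraph (Fin 2) (Fin m)).signlessEigenvalueCount (Set.Ico 0 1) := by
    rw [signlessEigenvalueCount_eq_card, card_pos]
    obtain ⟨i, hi⟩ := exists_eigenvalues_eq (t := 0)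
      (G := completeBipartiteGraph (Fin 2) (Fin m)) (x := Sum.elim (fun _ => 1) (fun _ => -1))
      (fun h => by simpa using congrFun h (Sum.inl 0)) (by
        funext v
        rw [signlessLapMatrix_mulVec_apply, zero_smul]
        refine sum_eq_zero fun u _ => ?_
        rcases u with u | u <;> rcases v with v | v <;> simp)
    exact ⟨i, mem_filter.2 ⟨mem_univ _, by simp [hi]⟩⟩
  omega

theorem signlessEigenvalueCount_pathGraph_six [DecidableRel (pathGraph 6).Adj] :
    (pathGraph 6).signlessEigenvalueCount (Set.Ico 0 1) = 2 := by
  classical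
  refine le_antisymm ?_ ?_
  -- The vertices 1 and 4 dominate the path; the eigenvalues 0 and `2 - √3` below show that the
  -- resulting bound 2 is attained.
  · refine ((pathGraph 6).hasEnergyBound_empty.signlessEigenvalueCount_le (D := {1, 4})
      (by simp) fun v _ hv => ?_).trans (by decide)
    simp only [pathGraph_adj]
    revert v
    decide
  · rw [signlessEigenvalueCount_eq_card]
    have hs : √3 * √3 = (3 : ℝ) := Real.mul_self_sqrt (by norm_num)
    have hs1 : (1 : ℝ) < √3 := by
      rw [Real.lt_sqrt] <;> norm_num
    have hs2 : √3 < (2 : ℝ) := by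
      rw [Real.sqrt_lt'] <;> norm_num
    obtain ⟨i, hi⟩ := exists_eigenvalues_eq (G := pathGraph 6) (t := 0)
      (x := ![1, -1, 1, -1, 1, -1]) (fun h => by simpa using congrFun h 0) (by
        funext v
        rw [signlessLapMatrix_mulVec_apply]
        fin_cases v <;> simp [Fin.sum_univ_six, pathGraph_adj])
    obtain ⟨j, hj⟩ := exists_eigenvalues_eq (G := pathGraph 6) (t := 2 - √3)
      (x := ![√3 + 1, -2, √3 - 1, √3 - 1, -2, √3 + 1])
      (fun h => by
        have := congrFun h 1
        norm_num at this) (by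
        funext v
        rw [signlessLapMatrix_mulVec_apply]
        fin_cases v <;> simp [Fin.sum_univ_six, pathGraph_adj] <;> nlinarith)
    have hij : i ≠ j := by
      rintro rfl
      linarith
    rw [← card_pair hij]
    refine card_le_card fun l hl => mem_filter.2 ⟨mem_univ _, ?_⟩
    rw [mem_insert, mem_singleton] at hl
    rcases hl with rfl | rfl
    · simp [hi]
    · rw [hj]
      constructor <;> linarith

theorem matchingNumber_pathGraph_six : (pathGraph 6).matchingNumber = 3 := by
  refine le_antisymm ?_ ?_
  · refine (matchingNumber_le_card (S := {1, 3, 5}) ?_).trans (by decide)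
    simp only [pathGraph_adj]
    decide
  · have hf : (pathGraph 6).IsMate ![1, 0, 3, 2, 5, 4] := by
      constructor
      · unfold Function.Involutive
        decide
      · simp only [pathGraph_adj]
        decide
    have h6 : (univ.filter fun v : Fin 6 => ![1, 0, 3, 2, 5, 4] v ≠ v).card = 6 := by decide
    have := hf.card_moved_le
    omega

end Examples

end SimpleGraph

theorem mainTheorem2 :
    (∀ {V : Type*} [Fintype V] [DecidableEq V] (G : SimpleGraph V) [DecidableRel G.Adj],
      2 ≤ G.minDegree →
      (∀ k : ℕ, 0 < k →
        ¬ Nonempty (G ≃g SimpleGraph.disjointCopies k (SimpleGraph.cycleGraph 5))) →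
      (G.signlessEigenvalueCount (Set.Ico 0 1) : ℤ) ≤ (G.matchingNumber : ℤ) - 1) ∧
    (∀ (n : ℕ) [DecidableRel (completeBipartiteGraph (Fin 2) (Fin (n - 2))).Adj], 4 ≤ n →
      2 ≤ (completeBipartiteGraph (Fin 2) (Fin (n - 2))).minDegree ∧
      (∀ k : ℕ, 0 < k →
        ¬ Nonempty (completeBipartiteGraph (Fin 2) (Fin (n - 2)) ≃g
          SimpleGraph.disjointCopies k (SimpleGraph.cycleGraph 5))) ∧
      ((completeBipartiteGraph (Fin 2) (Fin (n - 2))).signlessEigenvalueCount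
          (Set.Ico 0 1) : ℤ) =
        ((completeBipartiteGraph (Fin 2) (Fin (n - 2))).matchingNumber : ℤ) - 1) ∧
    (∀ [DecidableRel (SimpleGraph.pathGraph 6).Adj],
      ((SimpleGraph.pathGraph 6).signlessEigenvalueCount (Set.Ico 0 1) : ℤ) =
        ((SimpleGraph.pathGraph 6).matchingNumber : ℤ) - 1) := by
  refine ⟨fun G _ hδ hC => ?_, fun n _ hn => ⟨?_, fun k hk => ?_, ?_⟩, ?_⟩
  · have := SimpleGraph.signlessEigenvalueCount_lt_matchingNumber G hδ hC
    omega
  · exact SimpleGraph.two_le_minDegree_completeBipartiteGraph (by omega)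
  · exact SimpleGraph.not_nonempty_completeBipartiteGraph_iso hk
  · have := SimpleGraph.signlessEigenvalueCount_completeBipartiteGraph_two
      (m := n - 2) (by omega)
    omega
  · intro _
    rw [SimpleGraph.signlessEigenvalueCount_pathGraph_six,
      SimpleGraph.matchingNumber_pathGraph_six]
    norm_num
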